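/- **Setting.** Work over the field $\mathbb{Q}(A)$ and put $d=-A^{2}-A^{-2}$. For $m,n\ge 0$ let $TL_{m,n}$ be the $\mathbb{Q}(A)$-vector space whose basis consists of the crossingless connections in a rectangle with $m$ marked points on the top edge and $n$ on the bottom edge; the product is stacking, each closed circle being replaced by $d$; $TL_n(d)=TL_{n,n}$. Let $e_i\in TL_n(d)$ be the standard cup–cap generators and let $f_n\in TL_n(d)$ be the Jones–Wenzl idempotent, $$f_n=\frac{1}{(\{n\}_{A^4})!}\sum_{\pi\in S_n}(A^{3})^{|\pi|}\,b_\pi,$$ where $b_\pi$ is the minimal positive braid inducing $\pi$, $|\pi|$ is its length, $\{k\}_q=1+q+\cdots+q^{k-1}$, $(\{n\}_q)!=\{1\}_q\cdots\{n\}_q$, and each braid generator is evaluated by the Kauffman bracket relation $\sigma_i\mapsto A\,\mathbb 1+A^{-1}e_i$. For $n\ge 1$ let $a_1,\dots,a_{2n-1}$ be natural numbers ($0$ allowed) with $a_1=a_{2n-1}=1$ and $|a_i-a_{i-1}|=1$ for $2\le i\le 2n-1$. The element $D_{a_1,\dots,a_{2n-1}}\in TL_n(d)$ is the following diagram. A trunk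 starts at the rightmost top point with label $a_1=1$. Going down, the remaining $n-1$ top strands are merged into it one by one, from right to left, at triple points, so that the trunk carries the labels $a_1,a_2,\dots,a_n$. Then the trunk is split in the mirror-image way, carrying the labels $a_n,a_{n+1},\dots,a_{2n-1}$, into the bottom strands. A segment of the trunk labelled $a$ stands for $a$ parallel strands with $f_a$ inserted. At a triple point with legs $1$ (left), $a$ (right) and $c=a\pm1$, all strands run through if $c=a+1$; if $c=a-1$, the leg $1$ is joined to the leftmost strand of the leg $a$ and the other $c$ strands run through. For crossingless connections $x,y$ in $TL_n(d)$, let $\bar y$ be the reflection of $y$ about the horizontal axis; glue the bottom edge of $x$ to the top edge of $\bar y$ and connect the top points of $x$ with the bottom points of $\bar y$ in order by parallel arcs around an annulus. If the result has $k$ homotopically trivial and $m$ homotopically non-trivial circles, put $\langle x,y\rangle=d^{k}z^{m}$. The bilinear extension $\langle\ ,\ \rangle:TL_n(d)\times TL_n(d)\to\mathbb{Q}(A)[z]$ is the bilinear form of generalized type $A$. **Theorem.** Let $n\ge1$, and let $(a_1,\dots,a_{2n-1})$ and $(b_1,\dots,b_{2n-1})$ be two different sequences as above. Then $$\langle D_{a_1,\dots,a_{2n-1}},\,D_{b_1,\dots,b_{2n-1}}\rangle=0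 .$$ -/

import Mathlib

noncomputable section

namespace TemperleyLieb

/-- The marked points of a rectangle with `m` points on the top edge and `n` on the bottom edge,
both numbered from left to right: `Sum.inl i` is the `i`-th top point and `Sum.inr j` the `j`-th
bottom point. -/
abbrev Point (m n : ℕ) : Type := Fin m ⊕ Fin n

/-- The position of a marked point when the boundary of the rectangle is traversed clockwise,
starting at the upper left corner. -/
def pos {m n : ℕ} : Point m n → ℕ
  | Sum.inl i => i
  | Sum.inr j => m + n - 1 - j

/-- A crossingless connection between the marked points of the rectangle (up to isotopy):
a perfect matching of the marked points, no two arcs of which interlace on the boundary. -/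
@[ext]
structure Diagram (m n : ℕ) where
  /-- the other endpoint of the arc that starts at a given point -/
  mate : Point m n → Point m n
  mate_mate : ∀ p, mate (mate p) = p
  mate_ne : ∀ p, mate p ≠ p
  noncrossing : ∀ p q, ¬ (pos p < pos q ∧ pos q < pos (mate p) ∧ pos (mate p) < pos (mate q))

instance (m n : ℕ) : Finite (Diagram m n) :=
  Finite.of_injective Diagram.mate fun _ _ h => Diagram.ext h

instance (m n : ℕ) : Fintype (Diagram m n) := Fintype.ofFinite _

theorem pos_swap {m n : ℕ} (p : Point m n) : pos p + pos p.swap + 1 = m + n := by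
  rcases p with i | j
  · have := i.isLt
    simp only [pos, Sum.swap_inl]
    omega
  · have := j.isLt
    simp only [pos, Sum.swap_inr]
    omega

/-- The reflection of a crossingless connection about the horizontal axis. -/
def Diagram.reflect {m n : ℕ} (D : Diagram m n) : Diagram n m where
  mate p := (D.mate p.swap).swap
  mate_mate p := by simp [D.mate_mate]
  mate_ne p h := D.mate_ne p.swap (by
    have := congrArg Sum.swap h
    simpa using this)
  noncrossing p q h := by
    have hp := pos_swap p
    have hq := pos_swap q
    have hp' := pos_swap (D.mate p.swap)
    have hq' := pos_swap (D.mate q.swap)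
    refine D.noncrossing (D.mate q.swap) (D.mate p.swap) ?_
    rw [D.mate_mate, D.mate_mate]
    omega

/-! ### Coefficients -/

/-- The field `ℚ(A)` of rational functions. -/
abbrev K : Type := RatFunc ℚ

/-- The variable `A`. -/
def A : K := RatFunc.X

/-- The value `d = -A⁻² - A²` of a trivial circle. -/
def d : K := -(A⁻¹) ^ 2 - A ^ 2

/-- `TL m n` is the space of formal `ℚ(A)`-linear combinations of crossingless connections
(the morphism space of the Temperley–Lieb category); `TL n n` is the Temperley–Lieb algebra. -/
abbrev TL (m n : ℕ) : Type := Diagram m n → K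

/-! ### Composition: stacking diagrams -/

/-- Points of `D₁` (on top) and `D₂` (below) that are directly joined when `D₂` is stacked below
`D₁`. -/
inductive StackAdj {m n k : ℕ} (D₁ : Diagram m n) (D₂ : Diagram n k) :
    Point m n ⊕ Point n k → Point m n ⊕ Point n k → Prop
  | upper (p : Point m n) : StackAdj D₁ D₂ (Sum.inl p) (Sum.inl (D₁.mate p))
  | lower (p : Point n k) : StackAdj D₁ D₂ (Sum.inr p) (Sum.inr (D₂.mate p))
  | middle (i : Fin n) : StackAdj D₁ D₂ (Sum.inl (Sum.inr i)) (Sum.inr (Sum.inl i))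

/-- The connected curves (arcs and circles) in the stack of `D₁` and `D₂`. -/
abbrev StackCurve {m n k : ℕ} (D₁ : Diagram m n) (D₂ : Diagram n k) : Type :=
  Quot (StackAdj D₁ D₂)

/-- The curve of the stack through a given point of the outer boundary. -/
def outerCurve {m n k : ℕ} (D₁ : Diagram m n) (D₂ : Diagram n k) : Point m k → StackCurve D₁ D₂
  | Sum.inl i => Quot.mk _ (Sum.inl (Sum.inl i))
  | Sum.inr j => Quot.mk _ (Sum.inr (Sum.inr j))

/-- The number of closed circles in the stack of `D₁` and `D₂`. -/
def stackCircles {m n k : ℕ} (D₁ : Diagram m n) (D₂ : Diagram n k) : ℕ :=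
  Nat.card {c : StackCurve D₁ D₂ // ∀ p, c ≠ outerCurve D₁ D₂ p}

/-- `E` is the crossingless connection that is left of the stack of `D₁` and `D₂` after the
closed circles are removed: each arc of `E` joins two points on one curve of the stack. -/
def IsStack {m n k : ℕ} (D₁ : Diagram m n) (D₂ : Diagram n k) (E : Diagram m k) : Prop :=
  ∀ p, outerCurve D₁ D₂ (E.mate p) = outerCurve D₁ D₂ p

open Classical in
/-- The product of the Temperley–Lieb category (`x` above `y`): the bilinear extension of
stacking, where each closed circle is replaced by the factor `d`. -/
def comp {m n k : ℕ} (x : TL m n) (y : TL n k) : TL m k := fun E =>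
  ∑ D₁ : Diagram m n, ∑ D₂ : Diagram n k,
    if IsStack D₁ D₂ E then d ^ stackCircles D₁ D₂ * x D₁ * y D₂ else 0

/-- The linear extension of the reflection about the horizontal axis. -/
def reflect {m n : ℕ} (x : TL m n) : TL n m := fun D => x D.reflect

open Classical in
/-- The linear extension of the operation that adds a vertical strand on the left of a diagram. -/
def addLeft {m n : ℕ} (x : TL m n) : TL (m + 1) (n + 1) := fun E =>
  ∑ D : Diagram m n,
    if E.mate (Sum.inl 0) = Sum.inr 0 ∧
        ∀ p : Point m n, E.mate (Sum.map Fin.succ Fin.succ p) = Sum.map Fin.succ Fin.succ (D.mate p)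
    then x D else 0

open Classical in
/-- For `m = n`, the identity diagram: the `i`-th top point is joined to the `i`-th bottom point.
(The two indices are kept apart only to avoid casts; it is used when they are equal.) -/
def wire (m n : ℕ) : TL m n := fun E =>
  if ∀ (i : Fin m) (j : Fin n), i.val = j.val → E.mate (Sum.inl i) = Sum.inr j then 1 else 0

open Classical in
/-- The generator `e_i` (`i` counted from `0`): a cup and a cap at the positions `i` and `i + 1`,
vertical strands elsewhere. -/
def e {n : ℕ} (i : Fin (n - 1)) : TL n n := fun E =>
  if E.mate (Sum.inl ⟨i, by omega⟩) = Sum.inl ⟨i + 1, by omega⟩ ∧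
      E.mate (Sum.inr ⟨i, by omega⟩) = Sum.inr ⟨i + 1, by omega⟩ ∧
      ∀ j : Fin n, j.val ≠ i.val → j.val ≠ i.val + 1 → E.mate (Sum.inl j) = Sum.inr j
  then 1 else 0

/-! ### Jones–Wenzl idempotents -/

/-- The Artin generator of the braid group, resolved by the Kauffman bracket skein relation. -/
def crossing {n : ℕ} (i : Fin (n - 1)) : TL n n := A • wire n n + A⁻¹ • e i

/-- The image in `TL n n` of a positive braid word. -/
def braidWord {n : ℕ} (w : List (Fin (n - 1))) : TL n n :=
  w.foldr (fun i x => comp (crossing i) x) (wire n n)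

/-- The adjacent transposition of `i` and `i + 1`. -/
def adjSwap {n : ℕ} (i : Fin (n - 1)) : Equiv.Perm (Fin n) :=
  Equiv.swap ⟨i, by omega⟩ ⟨i + 1, by omega⟩

/-- The permutation induced by a positive braid word. -/
def wordPerm {n : ℕ} (w : List (Fin (n - 1))) : Equiv.Perm (Fin n) := (w.map adjSwap).prod

theorem exists_word {n : ℕ} (π : Equiv.Perm (Fin n)) :
    {w : List (Fin (n - 1)) | wordPerm w = π}.Nonempty := by
  cases n with
  | zero => exact ⟨[], Subsingleton.elim _ _⟩
  | succ k =>
    have h : π ∈ Submonoid.closure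
        (Set.range fun i : Fin k => Equiv.swap i.castSucc i.succ) := by
      rw [Equiv.Perm.mclosure_swap_castSucc_succ]
      trivial
    induction h using Submonoid.closure_induction with
    | mem x hx =>
      obtain ⟨i, rfl⟩ := hx
      refine ⟨[i], ?_⟩
      simp only [Set.mem_ofPred_eq, wordPerm, List.map_cons, List.map_nil, List.prod_cons,
        List.prod_nil, mul_one]
      rfl
    | one => exact ⟨[], rfl⟩
    | mul x y _ _ hx hy =>
      obtain ⟨u, rfl⟩ := hx
      obtain ⟨v, rfl⟩ := hy
      exact ⟨u ++ v, by simp [wordPerm]⟩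

/-- A positive braid word of minimal length that induces the permutation `π`. -/
def minWord {n : ℕ} (π : Equiv.Perm (Fin n)) : List (Fin (n - 1)) :=
  Function.argminOn List.length {w | wordPerm w = π} (exists_word π)

/-- The quantum integer `{k}_q = 1 + q + ⋯ + q ^ (k - 1)`. -/
def qInt (q : K) (k : ℕ) : K := ∑ j ∈ Finset.range k, q ^ j

/-- The quantum factorial `{1}_q {2}_q ⋯ {n}_q`. -/
def qFactorial (q : K) (n : ℕ) : K := ∏ k ∈ Finset.Icc 1 n, qInt q k

/-- The Jones–Wenzl idempotent `f_n`: the sum of `A ^ (3 |π|) b_π` over all permutations `π`,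
divided by `{n}_{A ^ 4}!`, where `b_π` is the minimal positive braid that induces `π` and
`|π|` is its length. -/
def jonesWenzl (n : ℕ) : TL n n :=
  (qFactorial (A ^ 4) n)⁻¹ •
    ∑ π : Equiv.Perm (Fin n), (A ^ 3) ^ (minWord π).length • braidWord (minWord π)

/-! ### The elements `D` -/

open Classical in
/-- The wiring inside an admissible triple point with upper left leg `1`, upper right leg `a` and
lower leg `c`, where `c = a + 1` or `a = c + 1`. If `c = a + 1`, all strands run vertically.
If `a = c + 1`, one strand joins the left leg to the leftmost point of the right leg, and the
other `c` strands run from the right leg to the lower leg. -/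
def tripleWiring (a c : ℕ) : TL (a + 1) c := fun E =>
  if (∀ (i : Fin (a + 1)) (j : Fin c), i.val + c = j.val + (a + 1) →
        E.mate (Sum.inl i) = Sum.inr j) ∧
      (a = c + 1 → ∀ i i' : Fin (a + 1), i.val = 0 → i'.val = 1 →
        E.mate (Sum.inl i) = Sum.inl i')
  then 1 else 0

/-- The admissible triple point with legs `1`, `a` and `c`, with a Jones–Wenzl idempotent on each
leg (`f_1` is the identity). -/
def triplePoint (a c : ℕ) : TL (a + 1) c :=
  comp (addLeft (jonesWenzl a)) (comp (tripleWiring a c) (jonesWenzl c))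

/-- The upper half of `D`: a tree with `k` leaves. The trunk starts as the rightmost leaf and
carries the labels `s 1, …, s (k - 1), c`; at each triple point the next leaf on the left is
merged into it. -/
def halfTree (s : ℕ → ℕ) : (k c : ℕ) → TL k c
  | 0, c => wire 0 c
  | 1, c => wire 1 c
  | k + 2, c => comp (addLeft (halfTree s (k + 1) (s (k + 1)))) (triplePoint (s (k + 1)) c)

/-- The element `D_{a_1, …, a_{2n-1}}` of `TL n n`: the leaves on the top edge merge along
`a_1, …, a_n`, and the trunk splits again along `a_n, …, a_{2n-1}` into the leaves on the bottom
edge. Only the values `a 1, …, a (2 * n - 1)` matter. -/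
def D (n : ℕ) (a : ℕ → ℕ) : TL n n :=
  comp (halfTree a n (a n)) (reflect (halfTree (fun i => a (2 * n - i)) n (a n)))

/-- The sequence `a_1, …, a_{2n-1}` satisfies `a_1 = a_{2n-1} = 1` and `|a_i - a_{i-1}| = 1`. -/
structure Admissible (n : ℕ) (a : ℕ → ℕ) : Prop where
  first : a 1 = 1
  last : a (2 * n - 1) = 1
  step : ∀ i, 2 ≤ i → i ≤ 2 * n - 1 → |(a i : ℤ) - (a (i - 1) : ℤ)| = 1

/-! ### The bilinear form of generalized type A -/

/-- Points that are directly joined when `b`, reflected about the horizontal axis, is glued below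
`a`, and the top edge is connected with the bottom edge around the annulus. -/
inductive ClosureAdj {n : ℕ} (a b : Diagram n n) :
    Point n n ⊕ Point n n → Point n n ⊕ Point n n → Prop
  | upper (p : Point n n) : ClosureAdj a b (Sum.inl p) (Sum.inl (a.mate p))
  | lower (p : Point n n) : ClosureAdj a b (Sum.inr p) (Sum.inr (b.reflect.mate p))
  | middle (i : Fin n) : ClosureAdj a b (Sum.inl (Sum.inr i)) (Sum.inr (Sum.inl i))
  | closing (i : Fin n) : ClosureAdj a b (Sum.inl (Sum.inl i)) (Sum.inr (Sum.inr i))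

/-- The circles in the annulus that result from `a` and `b`. -/
abbrev Circle {n : ℕ} (a b : Diagram n n) : Type := Quot (ClosureAdj a b)

/-- The number of closing strands on a circle, that is, the number of its intersections with a
radial segment of the annulus that meets each of the `n` closing strands once and nothing else. -/
def closingStrands {n : ℕ} {a b : Diagram n n} (c : Circle a b) : ℕ :=
  Nat.card {i : Fin n // Quot.mk (ClosureAdj a b) (Sum.inl (Sum.inl i)) = c}

/-- The number of homotopically trivial circles. (A simple closed curve in the annulus winds
`0` or `±1` times around it, so it is trivial iff it meets a radial segment an even number of
times.) -/
def trivialCircles {n : ℕ} (a b : Diagram n n) : ℕ :=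
  Nat.card {c : Circle a b // Even (closingStrands c)}

/-- The number of homotopically non-trivial circles. -/
def essentialCircles {n : ℕ} (a b : Diagram n n) : ℕ :=
  Nat.card {c : Circle a b // Odd (closingStrands c)}

/-- The bilinear form of generalized type A, with values in `ℚ(A)[z]`: the bilinear extension
of `⟨a, b⟩ = d ^ k * z ^ m`, where `k` and `m` are the numbers of homotopically trivial and
non-trivial circles. -/
def form {n : ℕ} (x y : TL n n) : Polynomial K :=
  ∑ a : Diagram n n, ∑ b : Diagram n n,
    Polynomial.C (x a * y b) *
      (Polynomial.C d ^ trivialCircles a b * Polynomial.X ^ essentialCircles a b)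

end TemperleyLieb

end

/-! Write `*` for reflection. Each `D` is a product `T T'*` of two half trees, and the form of `x`
and `y` is the annular closure of `x y*`. The closure is a trace, so the form of `D_a` and `D_b` can
be computed from `T_a T'_a* T'_b T_b*` up to cyclic rotation. If the sequences differ at an index at
most `n`, the factor `T_b* T_a` vanishes; otherwise `T'_a* T'_b` does (`halfTree_orthogonal`).

Half trees are orthogonal for a Schur-type reason. If the trunk labels at the roots differ, the
product contains `f_c* y f_c'` with `c ≠ c'`. A crossingless connection between different numbers of
points has an arc joining two neighbours on the larger side (`exists_adjacent_cup`), and the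
idempotent there kills it (`e_comp_jonesWenzl`). If the root labels agree, the product contains the
same pairing of the trees one leaf shorter, with a strand added, and induction applies. The wiring
at the triple points plays no role.

The relation `e_i f_n = 0` comes from pairing `π` with `s_i π`: when the length goes up, `b_{s_i π}
= σ_i b_π`, and `e_i σ_i = -A⁻³ e_i` makes the two terms cancel. That the choice of minimal word is
irrelevant is Matsumoto's theorem (`Reduced.prod_eq`), together with the braid relations for the
Kauffman bracket.

Topological facts about diagrams are reduced to linear algebra. Coloring boundary points with three
colors represents a diagram by a 0/1 matrix, and stacking becomes matrix multiplication with circle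
value 3 (`colorMatrix_mul`). The scaled matrix determines both the diagram and the number of
circles, so associativity and the Temperley–Lieb relations follow from matrix identities. Traces
weighted by signs separate trivial from essential circles in the same way. -/

noncomputable section

namespace TemperleyLieb

/-! ### Curves of a stack -/

/-- Two involutions `α` (without fixed points) and `β` of a finite set: the orbit of a fixed point
`p` of `β` under the group they generate contains exactly one other fixed point `q` of `β`. -/
theorem exists_partner {X : Type*} [Finite X] (α β : Equiv.Perm X) (hα : ∀ x, α (α x) = x)
    (hne : ∀ x, α x ≠ x) (hβ : ∀ x, β (β x) = x) (p : X) (hp : β p = p) :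
    ∃ q, q ≠ p ∧ β q = q ∧
      (∀ s : X → Prop, (∀ x, s x → s (α x)) → (∀ x, s x → s (β x)) → s p → s q) ∧
      ∃ S : Set X, p ∈ S ∧ (∀ x ∈ S, α x ∈ S) ∧ (∀ x ∈ S, β x ∈ S) ∧
        ∀ x ∈ S, β x = x → x = p ∨ x = q := by
  set φ : Equiv.Perm X := β * α with hφ
  have hconj : β * φ * β⁻¹ = φ⁻¹ := by
    ext x
    rw [eq_comm, Equiv.Perm.inv_eq_iff_eq]
    simp [hφ, hβ, hα]
  have hβk : ∀ k : ℤ, β ((φ ^ k) p) = (φ ^ (-k)) p := by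
    intro k
    have h1 : β * φ ^ k * β⁻¹ = φ ^ (-k) := by
      rw [← conj_zpow, hconj, inv_zpow, zpow_neg]
    have h2 : β⁻¹ p = p := by rw [Equiv.Perm.inv_eq_iff_eq, hp]
    rw [← h1, Equiv.Perm.mul_apply, h2, Equiv.Perm.mul_apply]
  have hαk : ∀ k : ℤ, α ((φ ^ k) p) = (φ ^ (-(k + 1))) p := by
    intro k
    rw [← hβk, add_comm, zpow_add, zpow_one]
    simp [hφ, hβ]
  set N := Function.minimalPeriod (φ • ·) p with hN
  have hdvd : ∀ k : ℤ, (φ ^ k) p = p ↔ (N : ℤ) ∣ k := fun k =>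
    MulAction.zpow_smul_eq_iff_minimalPeriod_dvd (a := φ) (b := p) (n := k)
  have heq : ∀ k l : ℤ, (φ ^ k) p = (φ ^ l) p ↔ (N : ℤ) ∣ k - l := by
    intro k l
    rw [← hdvd, sub_eq_neg_add, zpow_add, Equiv.Perm.mul_apply, zpow_neg,
      Equiv.Perm.inv_eq_iff_eq]
  have hNpos : 0 < N := by
    refine Nat.pos_of_ne_zero fun h0 => ?_
    have := (hdvd (orderOf φ)).1 (by simp [pow_orderOf_eq_one])
    rw [h0] at this
    rw [Nat.cast_zero, zero_dvd_iff, Nat.cast_eq_zero] at this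
    exact (orderOf_pos φ).ne' this
  -- If `N = 2j + 1`, then `φ ^ j p` would be fixed by `α`. So `N = 2h`, and the partner of `p` is
  -- the antipodal point `φ ^ h p` of its cycle.
  have hpar : Even N := by
    by_contra hodd
    obtain ⟨j, hj⟩ := Nat.not_even_iff_odd.1 hodd
    apply hne ((φ ^ (j : ℤ)) p)
    rw [hαk, heq]
    exact ⟨-1, by push_cast [hj]; ring⟩
  obtain ⟨h, hh⟩ := hpar
  have hstep : ∀ s : X → Prop, (∀ x, s x → s (α x)) → (∀ x, s x → s (β x)) → s p →
      ∀ k : ℕ, s ((φ ^ k) p) := by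
    intro s h1 h2 h3 k
    induction k with
    | zero => simpa using h3
    | succ k ih =>
      rw [pow_succ', Equiv.Perm.mul_apply]
      exact h2 _ (h1 _ ih)
  refine ⟨(φ ^ (h : ℤ)) p, ?_, ?_, ?_, {x | ∃ k : ℤ, x = (φ ^ k) p}, ⟨0, by simp⟩, ?_, ?_, ?_⟩
  · rw [Ne, hdvd]
    intro hd
    have := Int.le_of_dvd (by omega) hd
    omega
  · rw [hβk, heq]
    exact ⟨-1, by push_cast [hh]; ring⟩
  · intro s h1 h2 h3
    simpa using hstep s h1 h2 h3 h
  · rintro x ⟨k, rfl⟩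
    exact ⟨_, hαk k⟩
  · rintro x ⟨k, rfl⟩
    exact ⟨_, hβk k⟩
  · rintro x ⟨k, rfl⟩ hx
    rw [hβk, heq] at hx
    obtain ⟨t, ht⟩ := hx
    rw [hdvd, heq]
    push_cast [hh] at ht ⊢
    obtain ⟨r, hr⟩ := Int.even_or_odd' t
    have hk : k = -(h * t) := by linarith
    rcases hr with hr | hr
    · left; exact ⟨-r, by rw [hk, hr]; ring⟩
    · right; exact ⟨-r - 1, by rw [hk, hr]; ring⟩

variable {m n k l : ℕ}

/-- The gluing involution of a stack; it fixes the points of the outer boundary. -/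
def glue : Point m n ⊕ Point n k → Point m n ⊕ Point n k
  | Sum.inl (Sum.inl i) => Sum.inl (Sum.inl i)
  | Sum.inl (Sum.inr i) => Sum.inr (Sum.inl i)
  | Sum.inr (Sum.inl i) => Sum.inl (Sum.inr i)
  | Sum.inr (Sum.inr i) => Sum.inr (Sum.inr i)

theorem glue_glue (x : Point m n ⊕ Point n k) : glue (glue x) = x := by
  rcases x with (x | x) | (x | x) <;> rfl

/-- The inclusion of the outer boundary into the points of a stack. -/
def outerPoint : Point m k → Point m n ⊕ Point n k
  | Sum.inl i => Sum.inl (Sum.inl i)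
  | Sum.inr j => Sum.inr (Sum.inr j)

theorem outerPoint_injective :
    Function.Injective (outerPoint : Point m k → Point m n ⊕ Point n k) := by
  rintro (x | x) (y | y) h <;> simp_all [outerPoint]

theorem glue_outerPoint (p : Point m k) :
    glue (outerPoint p : Point m n ⊕ Point n k) = outerPoint p := by
  rcases p with p | p <;> rfl

theorem exists_outerPoint_of_glue_eq {x : Point m n ⊕ Point n k} (h : glue x = x) :
    ∃ p, outerPoint p = x := by
  rcases x with (x | x) | (x | x)
  · exact ⟨Sum.inl x, rfl⟩
  · simp [glue] at h
  · simp [glue] at h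
  · exact ⟨Sum.inr x, rfl⟩

theorem outerCurve_eq (D₁ : Diagram m n) (D₂ : Diagram n k) (p : Point m k) :
    outerCurve D₁ D₂ p = Quot.mk _ (outerPoint p) := by
  rcases p with p | p <;> rfl

/-- Every curve of a stack that meets the outer boundary has exactly two endpoints there. -/
theorem exists_other_end (D₁ : Diagram m n) (D₂ : Diagram n k) (p : Point m k) :
    ∃ q, q ≠ p ∧ outerCurve D₁ D₂ q = outerCurve D₁ D₂ p ∧
      ∀ r, outerCurve D₁ D₂ r = outerCurve D₁ D₂ p → r = p ∨ r = q := by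
  -- A curve is traced by alternating arcs (`α`) and gluings (`β`); the fixed points of `glue` are
  -- exactly the outer points.
  have hα : Function.Involutive (Sum.map D₁.mate D₂.mate) := by
    rintro (x | x) <;> simp [Diagram.mate_mate]
  have hne : ∀ x, Sum.map D₁.mate D₂.mate x ≠ x := by
    rintro (x | x) <;> simp [Diagram.mate_ne]
  have hβ : Function.Involutive (glue : Point m n ⊕ Point n k → _) := glue_glue
  obtain ⟨q, hqp, hβq, hq, S, hpS, hαS, hβS, hS⟩ := exists_partner hα.toPerm hβ.toPerm hα hne hβ
    (outerPoint p) (glue_outerPoint p)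
  obtain ⟨q, rfl⟩ := exists_outerPoint_of_glue_eq hβq
  have hS' : ∀ x y, StackAdj D₁ D₂ x y → (x ∈ S) = (y ∈ S) := by
    intro x y hxy
    rw [eq_iff_iff]
    induction hxy with
    | upper p => exact ⟨hαS _, fun h => by simpa [hα, D₁.mate_mate] using hαS _ h⟩
    | lower p => exact ⟨hαS _, fun h => by simpa [hα, D₂.mate_mate] using hαS _ h⟩
    | middle i => exact ⟨hβS _, fun h => hβS _ h⟩
  refine ⟨q, fun h => hqp (by rw [h]), ?_, fun r hr => ?_⟩
  · rw [outerCurve_eq, outerCurve_eq]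
    refine hq (fun x => Quot.mk _ x = Quot.mk (StackAdj D₁ D₂) (outerPoint p)) ?_ ?_ rfl
    · rintro (x | x) hx
      · exact (Quot.sound (StackAdj.upper x)).symm.trans hx
      · exact (Quot.sound (StackAdj.lower x)).symm.trans hx
    · rintro ((x | x) | (x | x)) hx
      · exact hx
      · exact (Quot.sound (StackAdj.middle x)).symm.trans hx
      · exact (Quot.sound (StackAdj.middle x)).trans hx
      · exact hx
  · rw [outerCurve_eq, outerCurve_eq] at hr
    have : outerPoint r ∈ S := by
      exact (congrArg (Quot.lift (· ∈ S) hS') hr).mpr hpS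
    rcases hS _ this (glue_outerPoint r) with h | h
    · exact Or.inl (outerPoint_injective h)
    · exact Or.inr (outerPoint_injective h)

theorem IsStack.eq_or_eq {D₁ : Diagram m n} {D₂ : Diagram n k} {E : Diagram m k}
    (h : IsStack D₁ D₂ E) {p q : Point m k} (hpq : outerCurve D₁ D₂ p = outerCurve D₁ D₂ q) :
    q = p ∨ q = E.mate p := by
  obtain ⟨r, -, -, hr⟩ := exists_other_end D₁ D₂ p
  have h1 := hr _ hpq.symm
  have h2 := hr _ (h p)
  have h3 := E.mate_ne p
  grind

theorem IsStack.unique {D₁ : Diagram m n} {D₂ : Diagram n k} {E F : Diagram m k}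
    (hE : IsStack D₁ D₂ E) (hF : IsStack D₁ D₂ F) : E = F := by
  ext1
  funext p
  rcases hF.eq_or_eq (hE p).symm with h | h
  · exact absurd h (E.mate_ne p)
  · exact h

/-! ### A stack is crossingless -/

theorem pos_injective : Function.Injective (pos : Point m n → ℕ) := by
  rintro (x | x) (y | y) h <;> simp only [pos] at h <;>
    first
    | (congr 1; apply Fin.ext; omega)
    | omega

theorem sum_eq_zero_of_mate (D : Diagram m n) (u : Point m n → ZMod 2)
    (hu : ∀ p, u (D.mate p) = u p) : ∑ p, u p = 0 :=
  Finset.sum_involution (fun p _ => D.mate p)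
    (fun p _ => by rw [hu]; exact CharTwo.add_self_eq_zero _)
    (fun p _ _ => D.mate_ne p) (fun _ _ => Finset.mem_univ _) (fun p _ => D.mate_mate p)

/-- Groups the points into arcs, each arc being represented by its first end in clockwise order. -/
theorem sum_eq_sum_lower (D : Diagram m n) (f : Point m n → ZMod 2) :
    ∑ p, f p = ∑ p with pos p < pos (D.mate p), (f p + f (D.mate p)) := by
  rw [Finset.sum_add_distrib, ← Finset.sum_filter_add_sum_filter_not Finset.univ
    (fun p => pos p < pos (D.mate p))]
  congr 1
  refine Finset.sum_bij' (fun p _ => D.mate p) (fun p _ => D.mate p) ?_ ?_ ?_ ?_ ?_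
  · intro p hp
    have : pos p ≠ pos (D.mate p) := fun h => D.mate_ne p (pos_injective h).symm
    simp [D.mate_mate] at hp ⊢
    omega
  · intro p hp
    simp [D.mate_mate] at hp ⊢
    omega
  · simp [D.mate_mate]
  · simp [D.mate_mate]
  · simp [D.mate_mate]

/-- The parity of the number of pairs of a point of `u` that precedes a point of `v`. -/
def pairing (u v : Point m n → ZMod 2) : ZMod 2 :=
  ∑ p, ∑ q, if pos p < pos q then u p * v q else 0

/-- For two distinct arcs that do not interlace, the number of pairs of ends in which the first
arc's end precedes the second's is 0, 2 or 4, hence even. Interlacing arcs would give 1 or 3. -/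
theorem pairing_eq_zero (D : Diagram m n) (u v : Point m n → ZMod 2)
    (hu : ∀ p, u (D.mate p) = u p) (hv : ∀ p, v (D.mate p) = v p) (huv : ∀ p, u p * v p = 0) :
    pairing u v = 0 := by
  rw [pairing, sum_eq_sum_lower D]
  refine Finset.sum_eq_zero fun p hp => ?_
  rw [← Finset.sum_add_distrib, sum_eq_sum_lower D]
  refine Finset.sum_eq_zero fun q hq => ?_
  simp only [hu, hv]
  by_cases h0 : u p * v q = 0
  · simp [h0]
  have h1 : q ≠ p := by rintro rfl; exact h0 (huv _)
  have h2 : q ≠ D.mate p := by rintro rfl; exact h0 (by rw [hv]; exact huv _)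
  have h3 : D.mate q ≠ p := fun h => h2 (by rw [← h, D.mate_mate])
  have h4 : D.mate q ≠ D.mate p := fun h => h1 (by rw [← D.mate_mate q, h, D.mate_mate])
  have n1 := D.noncrossing p q
  have n2 := D.noncrossing q p
  simp only [Finset.mem_filter, Finset.mem_univ, true_and] at hp hq
  have := pos_injective.ne h1
  have := pos_injective.ne h2
  have := pos_injective.ne h3
  have := pos_injective.ne h4
  have e2 : u p * v q + u p * v q = 0 := CharTwo.add_self_eq_zero _
  by_cases c1 : pos p < pos q <;> by_cases c2 : pos (D.mate p) < pos q <;>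
  by_cases c3 : pos p < pos (D.mate q) <;> by_cases c4 : pos (D.mate p) < pos (D.mate q) <;>
  simp only [c1, c2, c3, c4, if_true, if_false, add_zero, zero_add, e2] <;> omega

/-- The parity of the number of pairs of a point of `u` to the left of a point of `v`. -/
def leftPairing (u v : Fin n → ZMod 2) : ZMod 2 := ∑ i, ∑ j, if i < j then u i * v j else 0

/-- The parity of the number of pairs of a point of `u` to the right of a point of `v`. -/
def rightPairing (u v : Fin n → ZMod 2) : ZMod 2 := ∑ i, ∑ j, if j < i then u i * v j else 0

theorem leftPairing_add_rightPairing (u v : Fin n → ZMod 2) (h : ∀ i, u i * v i = 0) :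
    leftPairing u v + rightPairing u v = (∑ i, u i) * ∑ j, v j := by
  simp only [leftPairing, rightPairing, ← Finset.sum_add_distrib, Finset.sum_mul_sum]
  refine Finset.sum_congr rfl fun i _ => Finset.sum_congr rfl fun j _ => ?_
  rcases lt_trichotomy i j with hij | rfl | hij
  · simp [hij, hij.le]
  · simp [h]
  · simp [hij, hij.le]

/-- Clockwise, the top edge is read left to right and then the bottom edge right to left; hence the
mixed term has only one order, and the bottom edge contributes `rightPairing`. -/
theorem pairing_elim (u₁ v₁ : Fin m → ZMod 2) (u₂ v₂ : Fin n → ZMod 2) :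
    pairing (Sum.elim u₁ u₂) (Sum.elim v₁ v₂) =
      leftPairing u₁ v₁ + (∑ i, u₁ i) * (∑ j, v₂ j) + rightPairing u₂ v₂ := by
  have h1 : ∀ (i : Fin m) (j : Fin n), (i : ℕ) < m + n - 1 - j := fun i j => by omega
  have h2 : ∀ (i : Fin m) (j : Fin n), ¬ (m + n - 1 - j < (i : ℕ)) := fun i j => by omega
  have h3 : ∀ (i j : Fin n), (m + n - 1 - i < m + n - 1 - (j : ℕ)) ↔ j < i := fun i j => by
    rw [Fin.lt_def]; omega
  simp only [pairing, Fintype.sum_sum_type, pos, Sum.elim_inl, Sum.elim_inr, h1, h2, h3, if_true,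
    if_false, Finset.sum_const_zero, Finset.sum_add_distrib, Fin.val_fin_lt,
    leftPairing, rightPairing, Finset.sum_mul_sum]
  ring

/-- A mod 2 intersection argument. The traces of the two curves on `D₁` and on `D₂` have pairing
zero. Adding the two pairings, the contributions of the middle line combine to a product of totals,
and what remains is the pairing on the outer boundary. It therefore vanishes, whereas interlacing
ends have pairing one. -/
theorem stack_noncrossing (D₁ : Diagram m n) (D₂ : Diagram n k) {p p' q q' : Point m k}
    (hp : ∀ r, outerCurve D₁ D₂ r = outerCurve D₁ D₂ p ↔ r = p ∨ r = p')
    (hq : ∀ r, outerCurve D₁ D₂ r = outerCurve D₁ D₂ q ↔ r = q ∨ r = q') :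
    ¬ (pos p < pos q ∧ pos q < pos p' ∧ pos p' < pos q') := by
  classical
  rintro ⟨h1, h2, h3⟩
  have hne : outerCurve D₁ D₂ p ≠ outerCurve D₁ D₂ q := by
    intro h
    rcases (hp q).1 h.symm with rfl | rfl <;> omega
  let ind (c : StackCurve D₁ D₂) : Point m n ⊕ Point n k → ZMod 2 :=
    fun x => if Quot.mk _ x = c then 1 else 0
  let u := ind (outerCurve D₁ D₂ p)
  let v := ind (outerCurve D₁ D₂ q)
  have hadj : ∀ c x y, StackAdj D₁ D₂ x y → ind c x = ind c y := by
    intro c x y hxy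
    simp only [ind, Quot.sound hxy]
  have huv : ∀ x, u x * v x = 0 := by
    intro x
    simp only [u, v, ind]
    split_ifs with h4 h5 <;> simp
    exact hne (h4.symm.trans h5)
  let top (w : Point m n ⊕ Point n k → ZMod 2) : Fin m → ZMod 2 := fun i => w (Sum.inl (Sum.inl i))
  let mid (w : Point m n ⊕ Point n k → ZMod 2) : Fin n → ZMod 2 := fun i => w (Sum.inl (Sum.inr i))
  let bot (w : Point m n ⊕ Point n k → ZMod 2) : Fin k → ZMod 2 := fun i => w (Sum.inr (Sum.inr i))
  have e1 : ∀ c, Sum.elim (top (ind c)) (mid (ind c)) = fun x => ind c (Sum.inl x) := by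
    intro c; funext x; rcases x with x | x <;> rfl
  have e2 : ∀ c, Sum.elim (mid (ind c)) (bot (ind c)) = fun x => ind c (Sum.inr x) := by
    intro c; funext x; rcases x with x | x
    · exact hadj c _ _ (StackAdj.middle x)
    · rfl
  have m1 : ∀ c x, ind c (Sum.inl (D₁.mate x)) = ind c (Sum.inl x) := fun c x =>
    (hadj c _ _ (StackAdj.upper x)).symm
  have m2 : ∀ c x, ind c (Sum.inr (D₂.mate x)) = ind c (Sum.inr x) := fun c x =>
    (hadj c _ _ (StackAdj.lower x)).symm
  have I1 : pairing (Sum.elim (top u) (mid u)) (Sum.elim (top v) (mid v)) = 0 := by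
    rw [e1, e1]
    exact pairing_eq_zero D₁ _ _ (m1 _) (m1 _) fun x => huv _
  have I2 : pairing (Sum.elim (mid u) (bot u)) (Sum.elim (mid v) (bot v)) = 0 := by
    rw [e2, e2]
    exact pairing_eq_zero D₂ _ _ (m2 _) (m2 _) fun x => huv _
  have s1 : ∀ c, ∑ i, top (ind c) i + ∑ i, mid (ind c) i = 0 := by
    intro c
    have := sum_eq_zero_of_mate D₁ (fun x => ind c (Sum.inl x)) (m1 c)
    rwa [Fintype.sum_sum_type] at this
  have s2 : ∀ c, ∑ i, mid (ind c) i + ∑ i, bot (ind c) i = 0 := by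
    intro c
    have := sum_eq_zero_of_mate D₂ (fun x => ind c (Sum.inr x)) (m2 c)
    rw [← e2, Fintype.sum_sum_type] at this
    exact this
  have hmid := leftPairing_add_rightPairing (mid u) (mid v) fun i => huv _
  have I0 : pairing (Sum.elim (top u) (bot u)) (Sum.elim (top v) (bot v)) = 0 := by
    rw [pairing_elim] at I1 I2 ⊢
    have t1 := s1 (outerCurve D₁ D₂ p)
    have t2 := s2 (outerCurve D₁ D₂ p)
    have t3 := s1 (outerCurve D₁ D₂ q)
    have t4 := s2 (outerCurve D₁ D₂ q)
    change ∑ i, top u i + ∑ i, mid u i = 0 at t1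
    change ∑ i, mid u i + ∑ i, bot u i = 0 at t2
    change ∑ i, top v i + ∑ i, mid v i = 0 at t3
    change ∑ i, mid v i + ∑ i, bot v i = 0 at t4
    generalize ∑ i, top u i = a1 at *
    generalize ∑ i, mid u i = a2 at *
    generalize ∑ i, bot u i = a3 at *
    generalize ∑ i, top v i = b1 at *
    generalize ∑ i, mid v i = b2 at *
    generalize ∑ i, bot v i = b3 at *
    generalize leftPairing (top u) (top v) = x1 at *
    generalize leftPairing (mid u) (mid v) = x2 at *
    generalize rightPairing (mid u) (mid v) = x3 at *
    generalize rightPairing (bot u) (bot v) = x4 at *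
    clear * - I1 I2 hmid t1 t2 t3 t4
    -- Each curve meets the top, middle and bottom lines with the same parity, so only one total per
    -- curve survives.
    rw [CharTwo.add_eq_zero] at t1 t2 t3 t4
    subst t1 t2 t3 t4
    have z : ∀ x : ZMod 2, x + x = 0 := CharTwo.add_self_eq_zero
    linear_combination I1 + I2 - hmid - z (a1 * b1)
  have hpp : p ≠ p' := by rintro rfl; omega
  have hqq : q ≠ q' := by rintro rfl; omega
  have o : ∀ (r r' r'' : Point m k), r ≠ r' →
      (∀ s, outerCurve D₁ D₂ s = outerCurve D₁ D₂ r ↔ s = r ∨ s = r') →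
      Sum.elim (top (ind (outerCurve D₁ D₂ r))) (bot (ind (outerCurve D₁ D₂ r))) r'' =
        (if r'' = r then 1 else 0) + (if r'' = r' then 1 else 0) := by
    intro r r' r'' hr h
    have : Sum.elim (top (ind (outerCurve D₁ D₂ r))) (bot (ind (outerCurve D₁ D₂ r))) r'' =
      if outerCurve D₁ D₂ r'' = outerCurve D₁ D₂ r then 1 else 0 := by
      rcases r'' with x | x <;> rfl
    rw [this]
    have := h r''
    by_cases c1 : r'' = r <;> by_cases c2 : r'' = r' <;> simp_all
  -- Of the four pairs of ends, three are in order: `p, q`, then `p, q'` and `p', q'`.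
  have hone : pairing (Sum.elim (top u) (bot u)) (Sum.elim (top v) (bot v)) = 1 := by
    have o1 := fun r => o p p' r hpp hp
    have o2 := fun r => o q q' r hqq hq
    simp only [pairing, u, v, o1, o2]
    have a1 : pos p < pos q' := by omega
    have a2 : ¬ pos p' < pos q := by omega
    have key : ∀ r s : Point m k, (if pos r < pos s then
        ((if r = p then (1 : ZMod 2) else 0) + if r = p' then 1 else 0) *
          ((if s = q then 1 else 0) + if s = q' then 1 else 0) else 0) =
        (if r = p then if s = q then if pos r < pos s then 1 else 0 else 0 else 0) +
        (if r = p then if s = q' then if pos r < pos s then 1 else 0 else 0 else 0) +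
        (if r = p' then if s = q then if pos r < pos s then 1 else 0 else 0 else 0) +
        (if r = p' then if s = q' then if pos r < pos s then 1 else 0 else 0 else 0) := by
      intro r s
      split_ifs <;> decide
    simp only [key, Finset.sum_add_distrib, Finset.sum_ite_irrel, Finset.sum_const_zero,
      Finset.sum_ite_eq', Finset.mem_univ, if_true, h1, h3, a1, a2, if_false]
    decide
  rw [I0] at hone
  exact absurd hone (by decide)

theorem exists_isStack (D₁ : Diagram m n) (D₂ : Diagram n k) : ∃ E, IsStack D₁ D₂ E := by
  choose f hne hf huniq using exists_other_end D₁ D₂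
  have hiff : ∀ p r, outerCurve D₁ D₂ r = outerCurve D₁ D₂ p ↔ r = p ∨ r = f p := by
    intro p r
    refine ⟨huniq p r, ?_⟩
    rintro (rfl | rfl)
    · rfl
    · exact hf _
  refine ⟨⟨f, fun p => ?_, hne, fun p q => stack_noncrossing D₁ D₂ (hiff p) (hiff q)⟩, hf⟩
  rcases huniq p (f (f p)) ((hf _).trans (hf _)) with h | h
  · exact h
  · exact absurd h (hne _)

/-- The crossingless connection that remains of a stack when its circles are removed. -/
def stack (D₁ : Diagram m n) (D₂ : Diagram n k) : Diagram m k := (exists_isStack D₁ D₂).choose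

theorem isStack_stack (D₁ : Diagram m n) (D₂ : Diagram n k) : IsStack D₁ D₂ (stack D₁ D₂) :=
  (exists_isStack D₁ D₂).choose_spec

theorem isStack_iff {D₁ : Diagram m n} {D₂ : Diagram n k} {E : Diagram m k} :
    IsStack D₁ D₂ E ↔ E = stack D₁ D₂ :=
  ⟨fun h => h.unique (isStack_stack _ _), fun h => h ▸ isStack_stack _ _⟩

/-! ### Color matrices -/

/-- The coloring of the boundary points by `s` is constant on the arcs of `D`. -/
def Diagram.Fits (D : Diagram m n) (s : Point m n → Fin 3) : Prop := ∀ p, s (D.mate p) = s p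

open Classical in
/-- The matrix of a crossingless connection, indexed by the colorings of the top and the bottom
edge: an entry is `1` if the coloring of the boundary is constant on the arcs, otherwise `0`. -/
def colorMatrix (D : Diagram m n) : Matrix (Fin m → Fin 3) (Fin n → Fin 3) ℤ := fun σ τ =>
  if D.Fits (Sum.elim σ τ) then 1 else 0

theorem exists_elim (s : Point m n → Fin 3) : ∃ σ τ, s = Sum.elim σ τ :=
  ⟨_, _, (Sum.elim_comp_inl_inr s).symm⟩

/-- A crossingless connection and a number of circles are determined by the scaled matrix. -/
theorem eq_of_smul_colorMatrix_eq {E F : Diagram m n} {a b : ℕ}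
    (h : (3 : ℤ) ^ a • colorMatrix E = (3 : ℤ) ^ b • colorMatrix F) : a = b ∧ E = F := by
  classical
  have hab : a = b := by
    -- A constant coloring fits every diagram, so this entry compares the bare powers of 3.
    have := congrFun (congrFun h fun _ => 0) fun _ => 0
    have hc : ∀ D : Diagram m n, D.Fits (Sum.elim (fun _ => 0) fun _ => 0) := by
      intro D p
      rcases p with p | p <;> rcases D.mate _ with q | q <;> rfl
    simp only [Matrix.smul_apply, colorMatrix, hc, if_true, smul_eq_mul, mul_one] at this
    exact Int.pow_right_injective (by norm_num) this
  refine ⟨hab, ?_⟩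
  subst hab
  have hEF := smul_right_injective _ (pow_ne_zero a (by norm_num : (3 : ℤ) ≠ 0)) h
  ext1
  funext p
  by_contra hp
  -- Highlighting one arc of `E` fits `E`, but not `F` if `F` joins `p` to another point.
  let s : Point m n → Fin 3 := fun q => if q = p ∨ q = E.mate p then 1 else 0
  have hE : E.Fits s := by
    intro q
    have : (E.mate q = p ∨ E.mate q = E.mate p) ↔ (q = p ∨ q = E.mate p) := by
      constructor
      · rintro (rfl | h)
        · right; rw [E.mate_mate]
        · left; rw [← E.mate_mate q, h, E.mate_mate]
      · rintro (rfl | rfl)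
        · right; rfl
        · left; rw [E.mate_mate]
    simp only [s, this]
  have hF : ¬ F.Fits s := by
    intro hF
    have := hF p
    have h1 := F.mate_ne p
    have h2 : F.mate p ≠ E.mate p := fun h => hp h.symm
    simp [s, h1, h2] at this
  obtain ⟨σ, τ, hs⟩ := exists_elim s
  have := congrFun (congrFun hEF σ) τ
  rw [hs] at hE hF
  simp [colorMatrix, hE, hF] at this

/-- Elements of `Y` outside the range of `o` are colored freely. For `o = outerCurve D₁ D₂` these
are the closed circles of a stack. -/
theorem card_extensions {X Y : Type*} [Finite Y] (o : X → Y) (s : X → Fin 3)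
    (hs : ∀ p q, o p = o q → s p = s q) :
    Nat.card {f : Y → Fin 3 // ∀ p, f (o p) = s p} = 3 ^ Nat.card {c : Y // ∀ p, c ≠ o p} := by
  classical
  have hg : ∀ p, Function.extend o s 0 (o p) = s p := fun p =>
    Function.FactorsThrough.extend_apply (fun p q => hs p q) _ _
  have e : {f : Y → Fin 3 // ∀ p, f (o p) = s p} ≃ ({c : Y // ∀ p, c ≠ o p} → Fin 3) :=
    { toFun := fun f c => f.1 c.1
      invFun := fun h => ⟨fun c => if hc : ∀ p, c ≠ o p then h ⟨c, hc⟩ else Function.extend o s 0 c,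
        fun p => by
          have : ¬ ∀ q, o p ≠ o q := fun h => h p rfl
          simp only [dif_neg this, hg]⟩
      left_inv := by
        rintro ⟨f, hf⟩
        ext1
        funext c
        by_cases hc : ∀ p, c ≠ o p
        · simp only [dif_pos hc]
        · simp only [dif_neg hc]
          push Not at hc
          obtain ⟨p, rfl⟩ := hc
          rw [hg, hf]
      right_inv := by
        intro h
        funext c
        simp only [dif_pos c.2] }
  rw [Nat.card_congr e, Nat.card_fun, Nat.card_fin]

/-- Colorings of the curves of a stack are colorings of the two diagrams that agree on the
middle. -/
def curveColoringEquiv (D₁ : Diagram m n) (D₂ : Diagram n k) (σ : Fin m → Fin 3)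
    (τ : Fin k → Fin 3) :
    {f : StackCurve D₁ D₂ → Fin 3 // ∀ p, f (outerCurve D₁ D₂ p) = Sum.elim σ τ p} ≃
      {μ : Fin n → Fin 3 // D₁.Fits (Sum.elim σ μ) ∧ D₂.Fits (Sum.elim μ τ)} where
  toFun f := ⟨fun i => f.1 (Quot.mk _ (Sum.inl (Sum.inr i))), by
    obtain ⟨f, hf⟩ := f
    have h1 : (Sum.elim σ fun i => f (Quot.mk _ (Sum.inl (Sum.inr i)))) =
        fun p : Point m n => f (Quot.mk _ (Sum.inl p)) := by
      funext p
      rcases p with p | p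
      · exact (hf (Sum.inl p)).symm
      · rfl
    have h2 : (Sum.elim (fun i => f (Quot.mk _ (Sum.inl (Sum.inr i)))) τ) =
        fun p : Point n k => f (Quot.mk _ (Sum.inr p)) := by
      funext p
      rcases p with p | p
      · exact congrArg f (Quot.sound (StackAdj.middle p))
      · exact (hf (Sum.inr p)).symm
    simp only [h1, h2]
    exact ⟨fun p => congrArg f (Quot.sound (StackAdj.upper p)).symm,
      fun p => congrArg f (Quot.sound (StackAdj.lower p)).symm⟩⟩
  invFun μ := ⟨Quot.lift (Sum.elim (Sum.elim σ μ.1) (Sum.elim μ.1 τ)) (by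
      intro x y h
      induction h with
      | upper p => exact (μ.2.1 p).symm
      | lower p => exact (μ.2.2 p).symm
      | middle i => rfl), by rintro (p | p) <;> rfl⟩
  left_inv := by
    rintro ⟨f, hf⟩
    ext1
    funext c
    induction c using Quot.ind with
    | mk x =>
      rcases x with (x | x) | (x | x)
      · exact (hf (Sum.inl x)).symm
      · rfl
      · exact congrArg f (Quot.sound (StackAdj.middle x))
      · exact (hf (Sum.inr x)).symm
  right_inv := by
    rintro ⟨μ, h⟩
    rfl

/-- An entry of the product counts the colorings of the middle points that fit both diagrams, that
is, the colorings of the curves of the stack with prescribed ends. Arcs leave no choice, and each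
closed circle contributes a factor 3. -/
theorem colorMatrix_mul (D₁ : Diagram m n) (D₂ : Diagram n k) :
    colorMatrix D₁ * colorMatrix D₂ = (3 : ℤ) ^ stackCircles D₁ D₂ • colorMatrix (stack D₁ D₂) := by
  classical
  ext σ τ
  have h1 : (colorMatrix D₁ * colorMatrix D₂) σ τ =
      Nat.card {f : StackCurve D₁ D₂ → Fin 3 // ∀ p, f (outerCurve D₁ D₂ p) = Sum.elim σ τ p} := by
    rw [Nat.card_congr (curveColoringEquiv D₁ D₂ σ τ), Nat.card_eq_fintype_card,
      Fintype.card_subtype, Finset.card_filter]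
    push_cast
    simp only [Matrix.mul_apply, colorMatrix, ite_and, ite_mul, one_mul, zero_mul]
  rw [h1, Matrix.smul_apply, colorMatrix]
  have hst := isStack_stack D₁ D₂
  split_ifs with hfit
  · rw [card_extensions]
    · simp [stackCircles]
    · intro p q hpq
      rcases hst.eq_or_eq hpq with rfl | rfl
      · rfl
      · exact (hfit p).symm
  · rw [smul_zero, Nat.cast_eq_zero, Nat.card_eq_zero]
    left
    refine ⟨fun f => hfit fun p => ?_⟩
    rw [← f.2, ← f.2, hst p]

/-- The working tool: a stack and its circle count are read off from one matrix identity. -/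
theorem stack_eq_of_colorMatrix {D₁ : Diagram m n} {D₂ : Diagram n k} {E : Diagram m k} {a : ℕ}
    (h : colorMatrix D₁ * colorMatrix D₂ = (3 : ℤ) ^ a • colorMatrix E) :
    stackCircles D₁ D₂ = a ∧ stack D₁ D₂ = E := by
  rw [colorMatrix_mul] at h
  exact eq_of_smul_colorMatrix_eq h

theorem stack_assoc (D₁ : Diagram m n) (D₂ : Diagram n k) (D₃ : Diagram k l) :
    stackCircles D₁ D₂ + stackCircles (stack D₁ D₂) D₃ =
      stackCircles D₂ D₃ + stackCircles D₁ (stack D₂ D₃) ∧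
    stack (stack D₁ D₂) D₃ = stack D₁ (stack D₂ D₃) := by
  apply eq_of_smul_colorMatrix_eq
  have := Matrix.mul_assoc (colorMatrix D₁) (colorMatrix D₂) (colorMatrix D₃)
  rwa [colorMatrix_mul, colorMatrix_mul, Matrix.smul_mul, Matrix.mul_smul, colorMatrix_mul,
    colorMatrix_mul, smul_smul, smul_smul, ← pow_add, ← pow_add] at this

/-! ### The product -/

open Classical in
/-- The basis vector of a crossingless connection. -/
def single (D : Diagram m n) : TL m n := Pi.single D 1

theorem comp_apply (x : TL m n) (y : TL n k) :
    comp x y = ∑ D₁, ∑ D₂, (x D₁ * y D₂) • d ^ stackCircles D₁ D₂ • single (stack D₁ D₂) := by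
  classical
  funext E
  simp only [comp, Finset.sum_apply, Pi.smul_apply, single, Pi.single_apply, isStack_iff]
  refine Finset.sum_congr rfl fun D₁ _ => Finset.sum_congr rfl fun D₂ _ => ?_
  split_ifs
  · simp only [smul_eq_mul]; ring
  · simp

/-- The product as a bilinear map. -/
def compₗ : TL m n →ₗ[K] TL n k →ₗ[K] TL m k :=
  LinearMap.mk₂ K comp
    (fun x x' y => by
      simp only [comp_apply, Pi.add_apply, add_mul, add_smul, Finset.sum_add_distrib])
    (fun c x y => by
      simp only [comp_apply, Pi.smul_apply, smul_eq_mul, mul_assoc, mul_smul, Finset.smul_sum])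
    (fun x y y' => by
      simp only [comp_apply, Pi.add_apply, mul_add, add_smul, Finset.sum_add_distrib])
    (fun c x y => by
      simp only [comp_apply, Pi.smul_apply, smul_eq_mul, mul_left_comm _ c, mul_smul c,
        Finset.smul_sum])

@[simp] theorem compₗ_apply (x : TL m n) (y : TL n k) : compₗ x y = comp x y := rfl

theorem comp_zero (x : TL m n) : comp x (0 : TL n k) = 0 := (compₗ x).map_zero

theorem zero_comp (y : TL n k) : comp (0 : TL m n) y = 0 := by
  rw [← compₗ_apply, map_zero, LinearMap.zero_apply]

theorem comp_smul (c : K) (x : TL m n) (y : TL n k) : comp x (c • y) = c • comp x y :=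
  (compₗ x).map_smul c y

theorem smul_comp (c : K) (x : TL m n) (y : TL n k) : comp (c • x) y = c • comp x y := by
  rw [← compₗ_apply, map_smul, LinearMap.smul_apply, compₗ_apply]

theorem single_comp_single (D₁ : Diagram m n) (D₂ : Diagram n k) :
    comp (single D₁) (single D₂) = d ^ stackCircles D₁ D₂ • single (stack D₁ D₂) := by
  classical
  rw [comp_apply, Finset.sum_eq_single D₁, Finset.sum_eq_single D₂]
  · simp [single]
  · intro D _ h; simp [single, h]
  · simp
  · intro D _ h; simp [single, h]
  · simp

theorem ext_single {V : Type*} [AddCommMonoid V] [Module K V] {f g : TL m n →ₗ[K] V}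
    (h : ∀ D, f (single D) = g (single D)) : f = g := by
  classical
  refine LinearMap.pi_ext' fun D => LinearMap.ext_ring ?_
  simpa [single] using h D

theorem ext_single₂ {V : Type*} [AddCommMonoid V] [Module K V]
    {f g : TL m n →ₗ[K] TL k l →ₗ[K] V}
    (h : ∀ D E, f (single D) (single E) = g (single D) (single E)) : f = g :=
  ext_single fun D => ext_single fun E => h D E

theorem comp_assoc (x : TL m n) (y : TL n k) (z : TL k l) :
    comp (comp x y) z = comp x (comp y z) := by
  have h : ∀ D : Diagram m n, ∀ D' : Diagram n k, ∀ D'' : Diagram k l,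
      comp (comp (single D) (single D')) (single D'') =
        comp (single D) (comp (single D') (single D'')) := by
    intro D D' D''
    simp only [single_comp_single, comp_smul, smul_comp, smul_smul, ← pow_add]
    rw [(stack_assoc D D' D'').1, (stack_assoc D D' D'').2]
  have h1 : ∀ D : Diagram m n, ∀ D' : Diagram n k,
      comp (comp (single D) (single D')) z = comp (single D) (comp (single D') z) := by
    intro D D'
    exact LinearMap.congr_fun (f := compₗ (comp (single D) (single D')))
      (g := compₗ (single D) ∘ₗ compₗ (single D')) (ext_single fun D'' => h D D' D'') z
  have h2 : ∀ D : Diagram m n, comp (comp (single D) y) z = comp (single D) (comp y z) := by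
    intro D
    exact LinearMap.congr_fun (f := compₗ.flip z ∘ₗ compₗ (single D))
      (g := compₗ (single D) ∘ₗ compₗ.flip z) (ext_single fun D' => h1 D D') y
  exact LinearMap.congr_fun (f := compₗ.flip z ∘ₗ compₗ.flip y)
    (g := compₗ.flip (comp y z)) (ext_single h2) x

/-! ### Reflection -/

theorem reflect_reflect (D : Diagram m n) : D.reflect.reflect = D := by
  ext p
  simp [Diagram.reflect]

theorem reflect_single (D : Diagram m n) : reflect (single D) = single D.reflect := by
  classical
  funext E
  simp only [reflect, single, Pi.single_apply]
  congr 1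
  rw [eq_iff_iff]
  exact ⟨fun h => by rw [← h, reflect_reflect], fun h => by rw [h, reflect_reflect]⟩

/-- The reflection as a linear map. -/
def reflectₗ : TL m n →ₗ[K] TL n m where
  toFun := reflect
  map_add' _ _ := rfl
  map_smul' _ _ := rfl

theorem colorMatrix_reflect (D : Diagram m n) :
    colorMatrix D.reflect = (colorMatrix D).transpose := by
  funext σ τ
  simp only [Matrix.transpose, colorMatrix, Matrix.of_apply]
  congr 1
  have h : ∀ p : Point n m, Sum.elim σ τ p = Sum.elim τ σ p.swap := by rintro (p | p) <;> rfl
  simp only [Diagram.Fits, Diagram.reflect, h, Sum.swap_swap, eq_iff_iff]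
  exact ⟨fun H p => by simpa using H p.swap, fun H p => H p.swap⟩

theorem stack_reflect (D₁ : Diagram m n) (D₂ : Diagram n k) :
    stackCircles D₂.reflect D₁.reflect = stackCircles D₁ D₂ ∧
      stack D₂.reflect D₁.reflect = (stack D₁ D₂).reflect := by
  apply stack_eq_of_colorMatrix
  rw [colorMatrix_reflect, colorMatrix_reflect, ← Matrix.transpose_mul, colorMatrix_mul,
    Matrix.transpose_smul, colorMatrix_reflect]

theorem reflect_smul (c : K) (x : TL m n) : reflect (c • x) = c • reflect x := rfl

theorem reflect_zero : reflect (0 : TL m n) = 0 := rfl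

theorem reflect_comp (x : TL m n) (y : TL n k) :
    reflect (comp x y) = comp (reflect y) (reflect x) := by
  have : (compₗ (m := m) (n := n) (k := k)).compr₂ reflectₗ =
      ((compₗ (m := k) (n := n) (k := m)).flip.compl₂ reflectₗ) ∘ₗ reflectₗ := by
    refine ext_single₂ fun D E => ?_
    change reflect (comp (single D) (single E)) = comp (reflect (single E)) (reflect (single D))
    rw [reflect_single, reflect_single, single_comp_single, single_comp_single, reflect_smul,
      reflect_single, (stack_reflect D E).1, (stack_reflect D E).2]
  exact LinearMap.congr_fun (LinearMap.congr_fun this x) y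

/-! ### Strands added on the left -/

theorem forall_point_succ {P : Point (m + 1) (n + 1) → Prop} :
    (∀ p, P p) ↔ P (Sum.inl 0) ∧ P (Sum.inr 0) ∧ ∀ p, P (Sum.map Fin.succ Fin.succ p) := by
  simp only [Sum.forall, Fin.forall_fin_succ, Sum.map_inl, Sum.map_inr]
  tauto

theorem pos_map_succ (p : Point m n) : pos (Sum.map Fin.succ Fin.succ p) = pos p + 1 := by
  rcases p with p | p
  · simp [pos]
  · have := p.isLt
    simp only [pos, Sum.map_inr, Fin.val_succ]
    omega

theorem pos_lt (p : Point m n) : pos p < m + n := by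
  have := pos_swap p
  omega

/-- A crossingless connection with a vertical strand added on the left. -/
def Diagram.addLeft (D : Diagram m n) : Diagram (m + 1) (n + 1) where
  mate := Sum.elim
    (Fin.cases (Sum.inr 0) fun i => Sum.map Fin.succ Fin.succ (D.mate (Sum.inl i)))
    (Fin.cases (Sum.inl 0) fun i => Sum.map Fin.succ Fin.succ (D.mate (Sum.inr i)))
  mate_mate := by
    have : ∀ p : Point m n, Sum.elim
        (Fin.cases (Sum.inr 0) fun i => Sum.map Fin.succ Fin.succ (D.mate (Sum.inl i)))
        (Fin.cases (Sum.inl 0) fun i => Sum.map Fin.succ Fin.succ (D.mate (Sum.inr i)))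
        (Sum.map Fin.succ Fin.succ p) = Sum.map Fin.succ Fin.succ (D.mate p) := by
      rintro (p | p) <;> rfl
    rw [forall_point_succ]
    refine ⟨rfl, rfl, fun p => ?_⟩
    rw [this, this, D.mate_mate]
  mate_ne := by
    rw [forall_point_succ]
    refine ⟨by simp, by simp, ?_⟩
    have inj : Function.Injective (Sum.map Fin.succ Fin.succ : Point m n → Point (m+1) (n+1)) :=
      (Fin.succ_injective _).sumMap (Fin.succ_injective _)
    rintro (p | p) h
    · exact D.mate_ne _ (inj h)
    · exact D.mate_ne _ (inj h)
  noncrossing := by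
    -- The ends of the new strand are the first and the last boundary point in clockwise order, so
    -- it interlaces with nothing.
    have h0 : pos (Sum.inl 0 : Point (m + 1) (n + 1)) = 0 := rfl
    have h1 : pos (Sum.inr 0 : Point (m + 1) (n + 1)) = m + n + 1 := by simp [pos]; omega
    have this : ∀ p : Point m n, Sum.elim
        (Fin.cases (Sum.inr 0) fun i => Sum.map Fin.succ Fin.succ (D.mate (Sum.inl i)))
        (Fin.cases (Sum.inl 0) fun i => Sum.map Fin.succ Fin.succ (D.mate (Sum.inr i)))
        (Sum.map Fin.succ Fin.succ p) = Sum.map Fin.succ Fin.succ (D.mate p) := by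
      rintro (p | p) <;> rfl
    have lt := fun p => pos_lt (m := m + 1) (n := n + 1) p
    rw [forall_point_succ]
    refine ⟨fun q => ?_, fun q => ?_, fun p => ?_⟩
    · have := lt (Sum.elim
        (Fin.cases (Sum.inr 0) fun i => Sum.map Fin.succ Fin.succ (D.mate (Sum.inl i)))
        (Fin.cases (Sum.inl 0) fun i => Sum.map Fin.succ Fin.succ (D.mate (Sum.inr i))) q)
      simp only [Sum.elim_inl, Fin.cases_zero, h1]
      omega
    · simp only [Sum.elim_inr, Fin.cases_zero, h0]
      omega
    · rw [this]
      revert p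
      suffices ∀ q p, ¬ (pos (Sum.map Fin.succ Fin.succ p : Point (m+1) (n+1)) < pos q ∧
          pos q < pos (Sum.map Fin.succ Fin.succ (D.mate p) : Point (m+1) (n+1)) ∧
          pos (Sum.map Fin.succ Fin.succ (D.mate p) : Point (m+1) (n+1)) < pos (Sum.elim
        (Fin.cases (Sum.inr 0) fun i => Sum.map Fin.succ Fin.succ (D.mate (Sum.inl i)))
        (Fin.cases (Sum.inl 0) fun i => Sum.map Fin.succ Fin.succ (D.mate (Sum.inr i))) q)) from
        fun p q => this q p
      rw [forall_point_succ]
      refine ⟨fun p => ?_, fun p => ?_, fun q p => ?_⟩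
      · rw [h0]; omega
      · simp only [Sum.elim_inr, Fin.cases_zero, h0]; omega
      · rw [this]
        simp only [pos_map_succ]
        have := D.noncrossing p q
        omega

theorem Diagram.addLeft_mate (D : Diagram m n) (p : Point m n) :
    D.addLeft.mate (Sum.map Fin.succ Fin.succ p) = Sum.map Fin.succ Fin.succ (D.mate p) := by
  rcases p with p | p <;> rfl

theorem eq_addLeft_iff (D : Diagram m n) (E : Diagram (m + 1) (n + 1)) :
    (E.mate (Sum.inl 0) = Sum.inr 0 ∧
        ∀ p : Point m n, E.mate (Sum.map Fin.succ Fin.succ p) =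
          Sum.map Fin.succ Fin.succ (D.mate p)) ↔ E = D.addLeft := by
  constructor
  · rintro ⟨h1, h2⟩
    ext1
    refine funext (forall_point_succ.2 ⟨h1, ?_, fun p => ?_⟩)
    · change E.mate (Sum.inr 0) = Sum.inl 0
      rw [← h1, E.mate_mate]
    · rw [h2, D.addLeft_mate]
  · rintro rfl
    exact ⟨rfl, D.addLeft_mate⟩

theorem addLeft_apply (x : TL m n) : addLeft x = ∑ D, x D • single D.addLeft := by
  classical
  funext E
  simp only [addLeft, eq_addLeft_iff, Finset.sum_apply, Pi.smul_apply, single, Pi.single_apply]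
  simp

/-- The addition of a strand as a linear map. -/
def addLeftₗ : TL m n →ₗ[K] TL (m + 1) (n + 1) where
  toFun := addLeft
  map_add' _ _ := by simp only [addLeft_apply, Pi.add_apply, add_smul, Finset.sum_add_distrib]
  map_smul' _ _ := by
    simp only [addLeft_apply, Pi.smul_apply, smul_eq_mul, mul_smul, Finset.smul_sum,
      RingHom.id_apply]

theorem addLeft_zero : addLeft (0 : TL m n) = 0 := addLeftₗ.map_zero

theorem addLeft_smul (c : K) (x : TL m n) : addLeft (c • x) = c • addLeft x :=
  addLeftₗ.map_smul c x

theorem addLeft_single (D : Diagram m n) : addLeft (single D) = single D.addLeft := by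
  classical
  rw [addLeft_apply, Finset.sum_eq_single D]
  · simp [single]
  · intro E _ h; simp [single, h]
  · simp

theorem Diagram.addLeft_reflect (D : Diagram m n) : D.reflect.addLeft = D.addLeft.reflect := by
  ext1
  refine funext (forall_point_succ.2 ⟨rfl, rfl, fun p => ?_⟩)
  rw [Diagram.addLeft_mate]
  rcases p with p | p
  · simp only [Diagram.reflect, Sum.map_inl, Sum.swap_inl]
    change _ = Sum.swap (D.addLeft.mate (Sum.map Fin.succ Fin.succ (Sum.inr p)))
    rw [D.addLeft_mate]
    rcases D.mate _ with q | q <;> rfl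
  · simp only [Diagram.reflect, Sum.map_inr, Sum.swap_inr]
    change _ = Sum.swap (D.addLeft.mate (Sum.map Fin.succ Fin.succ (Sum.inl p)))
    rw [D.addLeft_mate]
    rcases D.mate _ with q | q <;> rfl

theorem reflect_addLeft (x : TL m n) : reflect (addLeft x) = addLeft (reflect x) := by
  have : reflectₗ ∘ₗ (addLeftₗ : TL m n →ₗ[K] _) = addLeftₗ ∘ₗ reflectₗ := by
    refine ext_single fun D => ?_
    change reflect (addLeft (single D)) = addLeft (reflect (single D))
    rw [addLeft_single, reflect_single, reflect_single, addLeft_single, D.addLeft_reflect]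
  exact LinearMap.congr_fun this x

/-- Adding a strand tensors the color matrix with the 3 × 3 identity, which makes `addLeft`
compatible with stacking. -/
theorem colorMatrix_addLeft (D : Diagram m n) (c c' : Fin 3) (σ : Fin m → Fin 3)
    (τ : Fin n → Fin 3) :
    colorMatrix D.addLeft (Fin.cons c σ) (Fin.cons c' τ) =
      if c = c' then colorMatrix D σ τ else 0 := by
  classical
  have h : ∀ p : Point m n, Sum.elim (Fin.cons c σ : Fin (m + 1) → Fin 3)
      (Fin.cons c' τ : Fin (n + 1) → Fin 3) (Sum.map Fin.succ Fin.succ p) = Sum.elim σ τ p := by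
    rintro (p | p) <;> rfl
  have : D.addLeft.Fits (Sum.elim (Fin.cons c σ) (Fin.cons c' τ)) ↔
      c = c' ∧ D.Fits (Sum.elim σ τ) := by
    rw [Diagram.Fits, forall_point_succ]
    simp only [D.addLeft_mate, h]
    change c' = c ∧ c = c' ∧ _ ↔ _
    rw [eq_comm (a := c'), Diagram.Fits]
    tauto
  simp only [colorMatrix, this, ite_and]

theorem stack_addLeft (D₁ : Diagram m n) (D₂ : Diagram n k) :
    stackCircles D₁.addLeft D₂.addLeft = stackCircles D₁ D₂ ∧
      stack D₁.addLeft D₂.addLeft = (stack D₁ D₂).addLeft := by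
  apply stack_eq_of_colorMatrix
  ext σ τ
  obtain ⟨⟨c, σ⟩, rfl⟩ := (Fin.consEquiv fun _ => Fin 3).surjective σ
  obtain ⟨⟨c', τ⟩, rfl⟩ := (Fin.consEquiv fun _ => Fin 3).surjective τ
  rw [Matrix.mul_apply, ← (Fin.consEquiv fun _ => Fin 3).sum_comp, Fintype.sum_prod_type]
  have h := congrFun (congrFun (colorMatrix_mul D₁ D₂) σ) τ
  rw [Matrix.mul_apply] at h
  simp only [Fin.consEquiv, Equiv.coe_fn_mk, colorMatrix_addLeft, Matrix.smul_apply] at h ⊢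
  by_cases hc : c = c'
  · subst hc
    simpa [ite_mul, Finset.sum_ite_irrel] using h
  · rw [if_neg hc, smul_zero]
    refine Finset.sum_eq_zero fun c'' _ => Finset.sum_eq_zero fun μ _ => ?_
    split_ifs with h1 h2
    · exact absurd (h1.trans h2) hc
    all_goals simp

theorem addLeft_comp (x : TL m n) (y : TL n k) :
    addLeft (comp x y) = comp (addLeft x) (addLeft y) := by
  have : (compₗ (m := m) (n := n) (k := k)).compr₂ addLeftₗ =
      (compₗ.compl₂ addLeftₗ) ∘ₗ addLeftₗ := by
    refine ext_single₂ fun D E => ?_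
    change addLeft (comp (single D) (single E)) = comp (addLeft (single D)) (addLeft (single E))
    rw [addLeft_single, addLeft_single, single_comp_single, single_comp_single, addLeft_smul,
      addLeft_single, (stack_addLeft D E).1, (stack_addLeft D E).2]
  exact LinearMap.congr_fun (LinearMap.congr_fun this x) y

/-! ### The identity -/

/-- The identity diagram. -/
def Diagram.id (n : ℕ) : Diagram n n where
  mate := Sum.swap
  mate_mate := Sum.swap_swap
  mate_ne := by rintro (p | p) <;> simp
  noncrossing p q := by
    have := pos_swap p
    have := pos_swap q
    omega

theorem wire_eq (n : ℕ) : wire n n = single (Diagram.id n) := by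
  classical
  funext E
  simp only [wire, single, Pi.single_apply]
  congr 1
  rw [eq_iff_iff]
  constructor
  · intro h
    ext1
    funext p
    rcases p with p | p
    · exact h p p rfl
    · change E.mate (Sum.inr p) = Sum.inl p
      rw [← h p p rfl, E.mate_mate]
  · rintro rfl i j hij
    rw [Fin.ext hij]
    rfl

theorem colorMatrix_id (n : ℕ) : colorMatrix (Diagram.id n) = 1 := by
  classical
  ext σ τ
  simp only [colorMatrix, Matrix.one_apply]
  congr 1
  rw [eq_iff_iff]
  constructor
  · intro h
    funext i
    exact h (Sum.inr i)
  · rintro rfl (p | p) <;> rfl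

theorem wire_comp (x : TL m n) : comp (wire m m) x = x := by
  have : compₗ (wire m m) = (LinearMap.id : TL m n →ₗ[K] TL m n) := by
    refine ext_single fun D => ?_
    have := stack_eq_of_colorMatrix (D₁ := Diagram.id m) (D₂ := D) (E := D) (a := 0)
      (by rw [colorMatrix_id, Matrix.one_mul, pow_zero, one_smul])
    rw [wire_eq, compₗ_apply, single_comp_single, this.1, this.2, pow_zero, one_smul,
      LinearMap.id_apply]
  exact LinearMap.congr_fun this x

theorem comp_wire (x : TL m n) : comp x (wire n n) = x := by
  have : compₗ.flip (wire n n) = (LinearMap.id : TL m n →ₗ[K] TL m n) := by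
    refine ext_single fun D => ?_
    have := stack_eq_of_colorMatrix (D₁ := D) (D₂ := Diagram.id n) (E := D) (a := 0)
      (by rw [colorMatrix_id, Matrix.mul_one, pow_zero, one_smul])
    rw [wire_eq, LinearMap.flip_apply, compₗ_apply, single_comp_single, this.1, this.2, pow_zero,
      one_smul, LinearMap.id_apply]
  exact LinearMap.congr_fun this x

/-! ### The generators -/

/-- The position `i`, as a strand. -/
abbrev lo (i : Fin (n - 1)) : Fin n := ⟨i, by omega⟩

/-- The position `i + 1`, as a strand. -/
abbrev hi (i : Fin (n - 1)) : Fin n := ⟨i + 1, by omega⟩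

theorem lo_ne_hi (i : Fin (n - 1)) : lo i ≠ hi i := by
  simp [lo, hi]

/-- The cup–cap diagram. -/
def Diagram.e (i : Fin (n - 1)) : Diagram n n where
  mate := Sum.elim
    (fun j => if j = lo i then Sum.inl (hi i) else if j = hi i then Sum.inl (lo i) else Sum.inr j)
    (fun j => if j = lo i then Sum.inr (hi i) else if j = hi i then Sum.inr (lo i) else Sum.inl j)
  mate_mate := by
    have := lo_ne_hi i
    rintro (p | p) <;> simp only [Sum.elim_inl, Sum.elim_inr] <;> split_ifs with h1 h2 <;>
      simp_all [eq_comm]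
  mate_ne := by
    have := lo_ne_hi i
    rintro (p | p) <;> simp only [Sum.elim_inl, Sum.elim_inr] <;> split_ifs with h1 h2 <;>
      simp_all [eq_comm]
  noncrossing := by
    rintro (p | p) (q | q) <;> simp only [Sum.elim_inl, Sum.elim_inr] <;> split_ifs <;>
      simp_all only [pos, Fin.ext_iff] <;> omega

theorem e_eq (i : Fin (n - 1)) : e i = single (Diagram.e i) := by
  classical
  funext E
  simp only [e, single, Pi.single_apply]
  congr 1
  rw [eq_iff_iff]
  have hne := lo_ne_hi i
  constructor
  · rintro ⟨h1, h2, h3⟩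
    have h3' : ∀ j : Fin n, j ≠ lo i → j ≠ hi i → E.mate (Sum.inl j) = Sum.inr j := fun j a b =>
      h3 j (fun h => a (Fin.ext h)) (fun h => b (Fin.ext h))
    ext1
    funext p
    rcases p with p | p
    · by_cases c1 : p = lo i
      · rw [c1]; simpa [Diagram.e] using h1
      by_cases c2 : p = hi i
      · rw [c2, ← h1, E.mate_mate]; simp [Diagram.e, h1]
      · rw [h3' p c1 c2]; simp [Diagram.e, c1, c2]
    · by_cases c1 : p = lo i
      · rw [c1]; simpa [Diagram.e] using h2
      by_cases c2 : p = hi i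
      · rw [c2, ← h2, E.mate_mate]; simp [Diagram.e, h2]
      · rw [← h3' p c1 c2, E.mate_mate]; simp [h3' p c1 c2, Diagram.e, c1, c2]
  · rintro rfl
    refine ⟨by simp [Diagram.e], by simp [Diagram.e], fun j c1 c2 => ?_⟩
    simp [Diagram.e, Fin.ext_iff, c1, c2]

/-- Recolor the strands `i` and `i + 1`. -/
def recolor (i : Fin (n - 1)) (σ : Fin n → Fin 3) (c : Fin 3) : Fin n → Fin 3 :=
  fun j => if j = lo i ∨ j = hi i then c else σ j

@[simp] theorem recolor_lo (i : Fin (n - 1)) (σ : Fin n → Fin 3) (c : Fin 3) :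
    recolor i σ c (lo i) = c := by simp [recolor]

@[simp] theorem recolor_hi (i : Fin (n - 1)) (σ : Fin n → Fin 3) (c : Fin 3) :
    recolor i σ c (hi i) = c := by simp [recolor]

theorem recolor_self (i : Fin (n - 1)) (σ : Fin n → Fin 3) (c : Fin 3) (h : σ (lo i) = c)
    (h' : σ (hi i) = c) : recolor i σ c = σ := by
  funext j
  simp only [recolor]
  split_ifs with hj
  · rcases hj with rfl | rfl
    · exact h.symm
    · exact h'.symm
  · rfl

theorem fits_e_iff (i : Fin (n - 1)) (σ τ : Fin n → Fin 3) :
    (Diagram.e i).Fits (Sum.elim σ τ) ↔ σ (lo i) = σ (hi i) ∧ τ = recolor i σ (τ (lo i)) := by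
  have hne := lo_ne_hi i
  constructor
  · intro h
    have h1 := h (Sum.inl (lo i))
    have h2 := h (Sum.inr (lo i))
    simp only [Diagram.e, Sum.elim_inl, Sum.elim_inr, if_true] at h1 h2
    refine ⟨h1.symm, ?_⟩
    funext j
    simp only [recolor]
    split_ifs with hj
    · rcases hj with rfl | rfl
      · rfl
      · exact h2
    · push Not at hj
      have := h (Sum.inl j)
      simpa [Diagram.e, hj.1, hj.2] using this
  · rintro ⟨h1, h2⟩
    have h3 : τ (hi i) = τ (lo i) := by rw [h2]; simp
    have h4 : ∀ j, j ≠ lo i → j ≠ hi i → τ j = σ j := fun j a b => by rw [h2]; simp [recolor, a, b]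
    clear h2
    rintro (p | p) <;> simp only [Diagram.e, Sum.elim_inl, Sum.elim_inr] <;> split_ifs <;>
      simp_all

theorem colorMatrix_e_mul (i : Fin (n - 1)) {T : Type*}
    (X : Matrix (Fin n → Fin 3) T ℤ) (σ : Fin n → Fin 3) (τ : T) :
    (colorMatrix (Diagram.e i) * X) σ τ =
      if σ (lo i) = σ (hi i) then ∑ c, X (recolor i σ c) τ else 0 := by
  classical
  simp only [Matrix.mul_apply, colorMatrix, fits_e_iff]
  split_ifs with h
  · simp only [h, true_and, ite_mul, one_mul, zero_mul]
    rw [← Finset.sum_filter]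
    refine Finset.sum_bij' (fun μ _ => μ (lo i)) (fun c _ => recolor i σ c) ?_ ?_ ?_ ?_ ?_
    · simp
    · simp
    · intro μ hμ
      simp only [Finset.mem_filter, Finset.mem_univ, true_and] at hμ
      exact hμ.symm
    · simp
    · intro μ hμ
      simp only [Finset.mem_filter, Finset.mem_univ, true_and] at hμ
      rw [← hμ]
  · simp [h]

/-- The arc joining the two neighbours can change its color independently of all other arcs. -/
theorem colorMatrix_recolor {D : Diagram n k} {i : Fin (n - 1)}
    (hD : D.mate (Sum.inl (lo i)) = Sum.inl (hi i)) (σ : Fin n → Fin 3) (τ : Fin k → Fin 3)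
    (h : σ (lo i) = σ (hi i)) (c : Fin 3) :
    colorMatrix D (recolor i σ c) τ = colorMatrix D σ τ := by
  classical
  suffices ∀ (σ : Fin n → Fin 3) (c : Fin 3), D.Fits (Sum.elim σ τ) →
      D.Fits (Sum.elim (recolor i σ c) τ) by
    simp only [colorMatrix]
    congr 1
    rw [eq_iff_iff]
    refine ⟨fun h' => ?_, this σ c⟩
    have := this _ (σ (lo i)) h'
    convert this using 2
    funext j
    simp only [recolor]
    split_ifs with hj
    · rcases hj with rfl | rfl
      · rfl
      · exact h.symm
    · rfl
  intro σ c hσ p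
  have hD' : D.mate (Sum.inl (hi i)) = Sum.inl (lo i) := by rw [← hD, D.mate_mate]
  have hrec : ∀ q : Point n k, q ≠ Sum.inl (lo i) → q ≠ Sum.inl (hi i) →
      Sum.elim (recolor i σ c) τ q = Sum.elim σ τ q := by
    rintro (q | q) h1 h2
    · simp only [ne_eq, Sum.inl.injEq] at h1 h2
      simp [recolor, h1, h2]
    · rfl
  by_cases h1 : p = Sum.inl (lo i)
  · subst h1; rw [hD]; simp
  by_cases h2 : p = Sum.inl (hi i)
  · subst h2; rw [hD']; simp
  · rw [hrec p h1 h2, hrec, hσ]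
    · intro h; exact h2 (by rw [← hD, ← h, D.mate_mate])
    · intro h; exact h1 (by rw [← hD', ← h, D.mate_mate])

theorem colorMatrix_eq_zero {D : Diagram n k} {i : Fin (n - 1)}
    (hD : D.mate (Sum.inl (lo i)) = Sum.inl (hi i)) (σ : Fin n → Fin 3) (τ : Fin k → Fin 3)
    (h : σ (lo i) ≠ σ (hi i)) : colorMatrix D σ τ = 0 := by
  classical
  rw [colorMatrix, if_neg]
  intro hf
  have := hf (Sum.inl (lo i))
  rw [hD] at this
  exact h this.symm

theorem e_mate_lo (i : Fin (n - 1)) :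
    (Diagram.e i).mate (Sum.inl (lo i)) = Sum.inl (hi i) := by simp [Diagram.e]

/-- A generator on top of a diagram with a cup at the same position. -/
theorem e_comp_single {D : Diagram n k} {i : Fin (n - 1)}
    (hD : D.mate (Sum.inl (lo i)) = Sum.inl (hi i)) :
    comp (e i) (single D) = d • single D := by
  -- The three colors contribute equal terms, which gives one factor 3 and hence one circle.
  have := stack_eq_of_colorMatrix (D₁ := Diagram.e i) (D₂ := D) (E := D) (a := 1) (by
    ext σ τ
    rw [colorMatrix_e_mul, Matrix.smul_apply]
    split_ifs with h
    · simp [colorMatrix_recolor hD σ τ h]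
    · rw [colorMatrix_eq_zero hD σ τ h, smul_zero])
  rw [e_eq, single_comp_single, this.1, this.2, pow_one]

theorem e_comp_e (i : Fin (n - 1)) : comp (e i) (e i) = d • e i := by
  conv_lhs => arg 2; rw [e_eq]
  rw [e_comp_single (e_mate_lo i), e_eq]

theorem e_comm {i j : Fin (n - 1)} (hij : (i : ℕ) + 1 < j) :
    comp (e i) (e j) = comp (e j) (e i) := by
  have h : colorMatrix (Diagram.e i) * colorMatrix (Diagram.e j) =
      colorMatrix (Diagram.e j) * colorMatrix (Diagram.e i) := by
    -- The trailing identity matrix lets `colorMatrix_e_mul` expand both generators.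
    rw [← Matrix.mul_one (colorMatrix (Diagram.e i) * colorMatrix (Diagram.e j)),
      ← Matrix.mul_one (colorMatrix (Diagram.e j) * colorMatrix (Diagram.e i)), Matrix.mul_assoc,
      Matrix.mul_assoc]
    ext σ τ
    have n1 : lo i ≠ lo j := by simp [lo, Fin.ext_iff]; omega
    have n2 : lo i ≠ hi j := by simp [lo, hi, Fin.ext_iff]; omega
    have n3 : hi i ≠ lo j := by simp [lo, hi, Fin.ext_iff]; omega
    have n4 : hi i ≠ hi j := by simp [hi, Fin.ext_iff]; omega
    have a1 : ∀ c, recolor i σ c (lo j) = σ (lo j) := fun c => by simp [recolor, n1.symm, n3.symm]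
    have a2 : ∀ c, recolor i σ c (hi j) = σ (hi j) := fun c => by simp [recolor, n2.symm, n4.symm]
    have a3 : ∀ c, recolor j σ c (lo i) = σ (lo i) := fun c => by simp [recolor, n1, n2]
    have a4 : ∀ c, recolor j σ c (hi i) = σ (hi i) := fun c => by simp [recolor, n3, n4]
    have a5 : ∀ c c', recolor j (recolor i σ c) c' = recolor i (recolor j σ c') c := fun c c' => by
      funext s
      simp only [recolor]
      split_ifs with h1 h2 <;> first | rfl | grind
    simp only [colorMatrix_e_mul, a1, a2, a3, a4]
    by_cases h1 : σ (lo i) = σ (hi i) <;> by_cases h2 : σ (lo j) = σ (hi j) <;>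
      simp only [h1, h2, if_true, if_false, Finset.sum_const_zero]
    rw [Finset.sum_comm]
    exact Finset.sum_congr rfl fun c _ => Finset.sum_congr rfl fun c' _ => by rw [a5]
  rw [colorMatrix_mul (Diagram.e j)] at h
  have := stack_eq_of_colorMatrix h
  rw [e_eq, e_eq, single_comp_single, single_comp_single, this.1, this.2]

theorem e_braid {i j : Fin (n - 1)} (hij : (i : ℕ) + 1 = j ∨ (j : ℕ) + 1 = i) :
    comp (e i) (comp (e j) (e i)) = e i := by
  have h : colorMatrix (Diagram.e i) * (colorMatrix (Diagram.e j) * colorMatrix (Diagram.e i)) =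
      colorMatrix (Diagram.e i) := by
    ext σ τ
    simp only [colorMatrix_e_mul]
    split_ifs with h1
    · rcases hij with hij | hij
      · have hj : lo j = hi i := Fin.ext hij.symm
        have hne : hi j ≠ lo i ∧ hi j ≠ hi i := by simp [lo, hi, Fin.ext_iff]; omega
        have a1 : ∀ c, recolor i σ c (lo j) = c := fun c => by rw [hj, recolor_hi]
        have a2 : ∀ c, recolor i σ c (hi j) = σ (hi j) := fun c => by simp [recolor, hne]
        -- The middle generator forces the color chosen by the first one to be that of the third
        -- strand, and the last generator then forces the second choice to be the same; a single
        -- term survives.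
        simp only [a1, a2, Finset.sum_ite_eq', Finset.mem_univ, if_true]
        rw [Finset.sum_eq_single (σ (hi j))]
        · rw [recolor_self j _ _ (a1 _) (a2 _), colorMatrix_recolor (e_mate_lo i) _ _ h1]
        · intro c _ hc
          refine colorMatrix_eq_zero (e_mate_lo i) _ _ ?_
          rw [← hj, recolor_lo]
          have : lo i ≠ lo j ∧ lo i ≠ hi j := by simp [lo, hi, Fin.ext_iff]; omega
          simp [recolor, this]
          exact hc.symm
        · simp
      · have hj : hi j = lo i := Fin.ext hij
        have hne : lo j ≠ lo i ∧ lo j ≠ hi i := by simp [lo, hi, Fin.ext_iff]; omega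
        have a1 : ∀ c, recolor i σ c (hi j) = c := fun c => by rw [hj, recolor_lo]
        have a2 : ∀ c, recolor i σ c (lo j) = σ (lo j) := fun c => by simp [recolor, hne]
        simp only [a1, a2, Finset.sum_ite_eq, Finset.mem_univ, if_true]
        rw [Finset.sum_eq_single (σ (lo j))]
        · rw [recolor_self j _ _ (a2 _) (a1 _), colorMatrix_recolor (e_mate_lo i) _ _ h1]
        · intro c _ hc
          refine colorMatrix_eq_zero (e_mate_lo i) _ _ ?_
          rw [← hj, recolor_hi]
          have : hi i ≠ lo j ∧ hi i ≠ hi j := by simp [lo, hi, Fin.ext_iff]; omega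
          simp [recolor, this]
          exact hc
        · simp
    · rw [colorMatrix_eq_zero (e_mate_lo i) _ _ h1]
  rw [colorMatrix_mul, Matrix.mul_smul, colorMatrix_mul, smul_smul, ← pow_add] at h
  have := eq_of_smul_colorMatrix_eq (h.trans (one_smul ℤ _).symm |>.trans (by rw [pow_zero]) :
    _ = (3 : ℤ) ^ 0 • colorMatrix (Diagram.e i))
  rw [e_eq, e_eq, single_comp_single, comp_smul, single_comp_single, smul_smul, ← pow_add, this.1,
    this.2, pow_zero, one_smul]

/-! ### The annular form -/

/-- The form as a bilinear map. -/
def formₗ : TL n n →ₗ[K] TL n n →ₗ[K] Polynomial K :=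
  LinearMap.mk₂ K form
    (fun x x' y => by
      simp only [form, Pi.add_apply, add_mul, map_add, Finset.sum_add_distrib])
    (fun c x y => by
      simp only [form, Pi.smul_apply, smul_eq_mul, mul_assoc, map_mul, Finset.smul_sum,
        Polynomial.smul_eq_C_mul])
    (fun x y y' => by
      simp only [form, Pi.add_apply, mul_add, add_mul, map_add, Finset.sum_add_distrib])
    (fun c x y => by
      simp only [form, Pi.smul_apply, smul_eq_mul, mul_left_comm _ c, mul_assoc, map_mul,
        Finset.smul_sum, Polynomial.smul_eq_C_mul])

theorem form_single (a b : Diagram n n) : form (single a) (single b) =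
    Polynomial.C d ^ trivialCircles a b * Polynomial.X ^ essentialCircles a b := by
  classical
  rw [form, Finset.sum_eq_single a, Finset.sum_eq_single b]
  · simp [single]
  · intro D _ h; simp [single, h]
  · simp
  · intro D _ h; simp [single, h]
  · simp

/-- The trace of a matrix, weighted by the product of the weights of the colors. -/
def weightedTrace (w : Fin 3 → ℤ) (X : Matrix (Fin n → Fin 3) (Fin n → Fin 3) ℤ) : ℤ :=
  ∑ σ, X σ σ * ∏ i, w (σ i)

theorem weightedTrace_smul (w : Fin 3 → ℤ) (c : ℤ)
    (X : Matrix (Fin n → Fin 3) (Fin n → Fin 3) ℤ) :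
    weightedTrace w (c • X) = c * weightedTrace w X := by
  simp only [weightedTrace, Matrix.smul_apply, smul_eq_mul, Finset.mul_sum, mul_assoc]

/-- The weights are signs, so the two ends of an arc contribute 1. Hence the weight passes through
diagrams, which makes the weighted trace cyclic. -/
theorem prod_weight_eq {w : Fin 3 → ℤ} (hw : ∀ c, w c * w c = 1) {D : Diagram m n}
    {σ : Fin m → Fin 3} {τ : Fin n → Fin 3} (h : D.Fits (Sum.elim σ τ)) :
    ∏ i, w (σ i) = ∏ j, w (τ j) := by
  have h1 : ∏ p : Point m n, w (Sum.elim σ τ p) = 1 :=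
    Finset.prod_involution (fun p _ => D.mate p) (fun p _ => by rw [h p, hw])
      (fun p _ _ => D.mate_ne p) (fun _ _ => Finset.mem_univ _) (fun p _ => D.mate_mate p)
  have h2 : (∏ j, w (τ j)) * ∏ j, w (τ j) = 1 := by
    rw [← Finset.prod_mul_distrib]
    exact Finset.prod_eq_one fun j _ => hw _
  rw [Fintype.prod_sum_type] at h1
  simp only [Sum.elim_inl, Sum.elim_inr] at h1
  rw [← mul_one (∏ i, w (σ i)), ← h2, ← mul_assoc, h1, one_mul]

theorem weightedTrace_mul_comm {w : Fin 3 → ℤ} (hw : ∀ c, w c * w c = 1) (P : Diagram m n)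
    (Q : Diagram n m) : weightedTrace w (colorMatrix P * colorMatrix Q) =
      weightedTrace w (colorMatrix Q * colorMatrix P) := by
  classical
  simp only [weightedTrace, Matrix.mul_apply, Finset.sum_mul]
  rw [Finset.sum_comm]
  refine Finset.sum_congr rfl fun τ _ => Finset.sum_congr rfl fun σ _ => ?_
  rw [mul_comm (colorMatrix P σ τ)]
  by_cases h : P.Fits (Sum.elim σ τ)
  · rw [prod_weight_eq hw h]
  · have : colorMatrix P σ τ = 0 := if_neg h
    simp [this]

/-- Colorings of the circles of a closure are colorings of the two diagrams that agree on top and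
on the bottom. -/
def circleColoringEquiv (a b : Diagram n n) :
    (Circle a b → Fin 3) ≃ {s : (Fin n → Fin 3) × (Fin n → Fin 3) //
      a.Fits (Sum.elim s.1 s.2) ∧ b.reflect.Fits (Sum.elim s.2 s.1)} where
  toFun f := ⟨(fun i => f (Quot.mk _ (Sum.inl (Sum.inl i))),
      fun i => f (Quot.mk _ (Sum.inl (Sum.inr i)))), by
    have h1 : Sum.elim (fun i => f (Quot.mk _ (Sum.inl (Sum.inl i))))
        (fun i => f (Quot.mk _ (Sum.inl (Sum.inr i)))) =
        fun p : Point n n => f (Quot.mk _ (Sum.inl p)) := by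
      funext p
      rcases p with p | p <;> rfl
    have h2 : Sum.elim (fun i => f (Quot.mk _ (Sum.inl (Sum.inr i))))
        (fun i => f (Quot.mk _ (Sum.inl (Sum.inl i)))) =
        fun p : Point n n => f (Quot.mk _ (Sum.inr p)) := by
      funext p
      rcases p with p | p
      · exact congrArg f (Quot.sound (ClosureAdj.middle p))
      · exact congrArg f (Quot.sound (ClosureAdj.closing p))
    simp only [h1, h2]
    exact ⟨fun p => congrArg f (Quot.sound (ClosureAdj.upper p)).symm,
      fun p => congrArg f (Quot.sound (ClosureAdj.lower p)).symm⟩⟩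
  invFun s := Quot.lift (Sum.elim (Sum.elim s.1.1 s.1.2) (Sum.elim s.1.2 s.1.1)) (by
      intro x y h
      induction h with
      | upper p => exact (s.2.1 p).symm
      | lower p => exact (s.2.2 p).symm
      | middle i => rfl
      | closing i => rfl)
  left_inv := by
    intro f
    funext c
    induction c using Quot.ind with
    | mk x =>
      rcases x with (x | x) | (x | x)
      · rfl
      · rfl
      · exact congrArg f (Quot.sound (ClosureAdj.middle x))
      · exact congrArg f (Quot.sound (ClosureAdj.closing x))
  right_inv := by
    rintro ⟨s, h⟩
    rfl

/-- The numbers of trivial and essential circles are encoded in weighted traces. -/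
theorem weightedTrace_closure {w : Fin 3 → ℤ} (hw : ∀ c, w c * w c = 1) (a b : Diagram n n) :
    weightedTrace w (colorMatrix a * colorMatrix b.reflect) =
      3 ^ trivialCircles a b * (∑ c, w c) ^ essentialCircles a b := by
  classical
  have : Fintype (Circle a b) := Fintype.ofFinite _
  have h1 : weightedTrace w (colorMatrix a * colorMatrix b.reflect) =
      ∑ f : Circle a b → Fin 3, ∏ i, w (f (Quot.mk _ (Sum.inl (Sum.inl i)))) := by
    refine Eq.trans ?_ (Equiv.sum_comp (circleColoringEquiv a b) fun s => ∏ i, w (s.1.1 i)).symm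
    rw [← Finset.sum_subtype (Finset.univ.filter fun s : (Fin n → Fin 3) ×
      (Fin n → Fin 3) => a.Fits (Sum.elim s.1 s.2) ∧ b.reflect.Fits (Sum.elim s.2 s.1)) (by simp)
      (fun s => ∏ i, w (s.1 i)), Finset.sum_filter, Fintype.sum_prod_type]
    simp only [weightedTrace, Matrix.mul_apply, colorMatrix, Finset.sum_mul, ite_and, ite_mul,
      one_mul, zero_mul]
  have h2 : ∀ f : Circle a b → Fin 3, ∏ i, w (f (Quot.mk _ (Sum.inl (Sum.inl i)))) =
      ∏ c, w (f c) ^ closingStrands c := by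
    intro f
    rw [← Finset.prod_fiberwise Finset.univ
      (fun i : Fin n => (Quot.mk _ (Sum.inl (Sum.inl i)) : Circle a b))]
    refine Finset.prod_congr rfl fun c _ => ?_
    rw [Finset.prod_congr rfl (g := fun _ => w (f c)), Finset.prod_const, closingStrands,
      Nat.card_eq_fintype_card, Fintype.card_subtype]
    intro i hi
    rw [(Finset.mem_filter.1 hi).2]
  have hsq : ∀ c, w c ^ 2 = 1 := fun c => by rw [sq, hw]
  -- The sum over colorings factors over the circles. An even power of a sign is 1 and an odd power
  -- is the sign itself, so a trivial circle gives 3 and an essential one gives the sum of the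
  -- weights.
  rw [h1, Finset.sum_congr rfl fun f _ => h2 f,
    ← Fintype.prod_sum fun (c : Circle a b) (j : Fin 3) => w j ^ closingStrands c,
    Finset.prod_congr rfl (g := fun c : Circle a b =>
      if Even (closingStrands c) then (3 : ℤ) else ∑ c, w c)]
  · rw [Finset.prod_ite, Finset.prod_const, Finset.prod_const, trivialCircles, essentialCircles,
      Nat.card_eq_fintype_card, Nat.card_eq_fintype_card, Fintype.card_subtype,
      Fintype.card_subtype]
    simp only [Nat.not_even_iff_odd]
  · intro c _
    split_ifs with h
    · obtain ⟨r, hr⟩ := h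
      have : ∀ j, w j ^ closingStrands c = 1 := fun j => by
        rw [hr, ← two_mul, pow_mul, hsq, one_pow]
      simp [this]
    · obtain ⟨r, hr⟩ := Nat.not_even_iff_odd.1 h
      refine Finset.sum_congr rfl fun j _ => ?_
      rw [hr, pow_succ, pow_mul, hsq, one_pow, one_mul]

theorem exponents_eq {t s t' s' : ℕ} (h : ∀ w : Fin 3 → ℤ, (∀ c, w c * w c = 1) →
    (3 : ℤ) ^ t * (∑ c, w c) ^ s = 3 ^ t' * (∑ c, w c) ^ s') : t = t' ∧ s = s' := by
  -- Weights with sum 3 determine `t + s`; weights with sum 1 determine `t` alone.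
  have h1 := h (fun _ => 1) (by simp)
  have h2 := h ![1, 1, -1] (by decide)
  have e1 : ∑ c : Fin 3, (1 : ℤ) = 3 := by simp
  have e2 : ∑ c : Fin 3, (![1, 1, -1] : Fin 3 → ℤ) c = 1 := by decide
  rw [e1, ← pow_add, ← pow_add] at h1
  rw [e2, one_pow, one_pow, mul_one, mul_one] at h2
  have i1 := Int.pow_right_injective (by norm_num) h1
  have i2 := Int.pow_right_injective (by norm_num) h2
  omega

theorem reflect_id (n : ℕ) : (Diagram.id n).reflect = Diagram.id n := by
  ext p
  simp [Diagram.reflect, Diagram.id]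

theorem weightedTrace_id {w : Fin 3 → ℤ} (hw : ∀ c, w c * w c = 1) (a : Diagram n n) :
    weightedTrace w (colorMatrix a) =
      3 ^ trivialCircles a (Diagram.id n) * (∑ c, w c) ^ essentialCircles a (Diagram.id n) := by
  rw [← weightedTrace_closure hw, reflect_id, colorMatrix_id, Matrix.mul_one]

theorem weightedTrace_mul {w : Fin 3 → ℤ} (hw : ∀ c, w c * w c = 1) (P : Diagram m n)
    (Q : Diagram n m) : weightedTrace w (colorMatrix P * colorMatrix Q) =
      3 ^ (stackCircles P Q + trivialCircles (stack P Q) (Diagram.id m)) *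
        (∑ c, w c) ^ essentialCircles (stack P Q) (Diagram.id m) := by
  rw [colorMatrix_mul, weightedTrace_smul, weightedTrace_id hw, pow_add, mul_assoc]

theorem form_comp_single (P : Diagram m n) (Q : Diagram n m) :
    form (comp (single P) (single Q)) (wire m m) =
      Polynomial.C d ^ (stackCircles P Q + trivialCircles (stack P Q) (Diagram.id m)) *
        Polynomial.X ^ essentialCircles (stack P Q) (Diagram.id m) := by
  have : ∀ (c : K) (x y : TL m m), form (c • x) y = c • form x y := fun c x y =>
    LinearMap.congr_fun (formₗ.map_smul c x) y
  rw [single_comp_single, wire_eq, this, form_single, Polynomial.smul_eq_C_mul, map_pow, pow_add,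
    mul_assoc]

/-- The trace property: one factor is slid around the annulus. On basis diagrams both circle counts
are recovered from the cyclic weighted traces. -/
theorem form_comp_comm (x : TL m n) (y : TL n m) :
    form (comp x y) (wire m m) = form (comp y x) (wire n n) := by
  have : (compₗ (m := m) (n := n) (k := m)).compr₂ (formₗ.flip (wire m m)) =
      ((compₗ (m := n) (n := m) (k := n)).compr₂ (formₗ.flip (wire n n))).flip := by
    refine ext_single₂ fun P Q => ?_
    change form (comp (single P) (single Q)) _ = form (comp (single Q) (single P)) _
    have := exponents_eq fun w hw => (weightedTrace_mul hw P Q).symm.trans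
      ((weightedTrace_mul_comm hw P Q).trans (weightedTrace_mul hw Q P))
    rw [form_comp_single, form_comp_single, this.1, this.2]
  exact LinearMap.congr_fun (LinearMap.congr_fun this x) y

theorem form_eq_form_comp_reflect (x y : TL n n) :
    form x y = form (comp x (reflect y)) (wire n n) := by
  have : formₗ = ((compₗ (m := n) (n := n) (k := n)).compr₂ (formₗ.flip (wire n n))).compl₂
      reflectₗ := by
    refine ext_single₂ fun a b => ?_
    change form (single a) (single b) = form (comp (single a) (reflect (single b))) _
    have := exponents_eq fun w hw => (weightedTrace_closure hw a b).symm.trans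
      (weightedTrace_mul hw a b.reflect)
    rw [reflect_single, form_comp_single, form_single, this.1, this.2]
  exact LinearMap.congr_fun (LinearMap.congr_fun this x) y

theorem form_zero (y : TL n n) : form 0 y = 0 :=
  LinearMap.congr_fun (map_zero formₗ) y

/-! ### Lengths of permutations -/

/-- The set of inversions. -/
def inversions (ρ : Equiv.Perm (Fin n)) : Finset (Fin n × Fin n) :=
  {p | p.1 < p.2 ∧ ρ p.2 < ρ p.1}

theorem mem_inversions {ρ : Equiv.Perm (Fin n)} {a b : Fin n} :
    (a, b) ∈ inversions ρ ↔ a < b ∧ ρ b < ρ a := by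
  simp [inversions]

theorem adjSwap_mul_self (i : Fin (n - 1)) : adjSwap i * adjSwap i = 1 := Equiv.swap_mul_self _ _

theorem adjSwap_inv (i : Fin (n - 1)) : (adjSwap i)⁻¹ = adjSwap i := Equiv.swap_inv _ _

@[simp] theorem adjSwap_lo (i : Fin (n - 1)) : adjSwap i (lo i) = hi i := Equiv.swap_apply_left _ _

@[simp] theorem adjSwap_hi (i : Fin (n - 1)) : adjSwap i (hi i) = lo i := Equiv.swap_apply_right _ _

theorem adjSwap_adjSwap (i : Fin (n - 1)) (j : Fin n) : adjSwap i (adjSwap i j) = j :=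
  Equiv.swap_apply_self _ _ _

theorem adjSwap_of_ne (i : Fin (n - 1)) {j : Fin n} (h : j ≠ lo i) (h' : j ≠ hi i) :
    adjSwap i j = j := Equiv.swap_apply_of_ne_of_ne h h'

theorem adjSwap_lt_iff (i : Fin (n - 1)) {a b : Fin n} (h : ¬ (a = lo i ∧ b = hi i))
    (h' : ¬ (a = hi i ∧ b = lo i)) : adjSwap i a < adjSwap i b ↔ a < b := by
  by_cases a1 : a = lo i <;> by_cases a2 : a = hi i <;> by_cases b1 : b = lo i <;>
    by_cases b2 : b = hi i <;> simp_all [adjSwap_of_ne] <;>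
    simp only [lo, hi, Fin.ext_iff, Fin.lt_def] at * <;> omega

/-- Apart from the new pair `(lo i, hi i)`, the inversions are those of `ρ` with both entries moved
by `adjSwap i`, which preserves the order of every other pair. -/
theorem inversions_mul_adjSwap (ρ : Equiv.Perm (Fin n)) (i : Fin (n - 1))
    (h : ρ (lo i) < ρ (hi i)) :
    (inversions (ρ * adjSwap i)).card = (inversions ρ).card + 1 := by
  have hlt : lo i < hi i := by simp [lo, hi]
  have hnot : (lo i, hi i) ∉ (inversions ρ).map
      ((adjSwap i).prodCongr (adjSwap i)).toEmbedding := by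
    simp only [Finset.mem_map, Prod.exists, not_exists, not_and, mem_inversions]
    intro a b hab heq
    simp only [Equiv.toEmbedding_apply, Equiv.prodCongr_apply, Prod.map, Prod.mk.injEq] at heq
    rw [← adjSwap_adjSwap i a, ← adjSwap_adjSwap i b, heq.1, heq.2, adjSwap_lo, adjSwap_hi] at hab
    exact absurd hab.1 hlt.not_gt
  rw [← Finset.card_map (s := inversions ρ) ((adjSwap i).prodCongr (adjSwap i)).toEmbedding,
    ← Finset.card_insert_of_notMem hnot]
  congr 1
  ext ⟨a, b⟩
  rw [Finset.mem_insert, Finset.mem_map_equiv, Prod.mk.injEq, mem_inversions]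
  have hs : ((adjSwap i).prodCongr (adjSwap i)).symm (a, b) = (adjSwap i a, adjSwap i b) := by
    rw [Equiv.symm_apply_eq]
    simp [adjSwap_adjSwap]
  rw [hs, mem_inversions, Equiv.Perm.mul_apply, Equiv.Perm.mul_apply]
  by_cases c1 : a = lo i ∧ b = hi i
  · obtain ⟨rfl, rfl⟩ := c1
    simp [hlt, h]
  by_cases c2 : a = hi i ∧ b = lo i
  · obtain ⟨rfl, rfl⟩ := c2
    simp [hlt.not_gt, h.le, (lo_ne_hi i).symm]
  · rw [adjSwap_lt_iff i c1 c2]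
    tauto

/-- The length of a permutation. -/
def len (π : Equiv.Perm (Fin n)) : ℕ := (inversions π⁻¹).card

/-- `len` uses the inverse permutation because braid words grow on the left: inverting turns this
into multiplication on the right. -/
theorem len_ascent {π : Equiv.Perm (Fin n)} {i : Fin (n - 1)} (h : π⁻¹ (lo i) < π⁻¹ (hi i)) :
    len (adjSwap i * π) = len π + 1 := by
  rw [len, mul_inv_rev, adjSwap_inv, inversions_mul_adjSwap _ _ h, len]

theorem adjSwap_mul_adjSwap_mul (i : Fin (n - 1)) (π : Equiv.Perm (Fin n)) :
    adjSwap i * (adjSwap i * π) = π := by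
  rw [← mul_assoc, adjSwap_mul_self, one_mul]

theorem inv_adjSwap_mul (i : Fin (n - 1)) (π : Equiv.Perm (Fin n)) (j : Fin n) :
    (adjSwap i * π)⁻¹ j = π⁻¹ (adjSwap i j) := by
  rw [mul_inv_rev, adjSwap_inv, Equiv.Perm.mul_apply]

theorem len_descent {π : Equiv.Perm (Fin n)} {i : Fin (n - 1)} (h : π⁻¹ (hi i) < π⁻¹ (lo i)) :
    len (adjSwap i * π) + 1 = len π := by
  rw [← len_ascent (i := i), adjSwap_mul_adjSwap_mul]
  rwa [inv_adjSwap_mul, inv_adjSwap_mul, adjSwap_lo, adjSwap_hi]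

theorem ascent_or_descent (π : Equiv.Perm (Fin n)) (i : Fin (n - 1)) :
    π⁻¹ (lo i) < π⁻¹ (hi i) ∨ π⁻¹ (hi i) < π⁻¹ (lo i) :=
  lt_or_gt_of_ne fun h => lo_ne_hi i (π⁻¹.injective h)

theorem len_one : len (1 : Equiv.Perm (Fin n)) = 0 := by
  rw [len, Finset.card_eq_zero, inversions, Finset.filter_eq_empty_iff]
  rintro ⟨a, b⟩ -
  simp only [inv_one, Equiv.Perm.one_apply, not_and, not_lt]
  exact le_of_lt

theorem wordPerm_cons (i : Fin (n - 1)) (w : List (Fin (n - 1))) :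
    wordPerm (i :: w) = adjSwap i * wordPerm w := by
  simp [wordPerm]

theorem len_wordPerm_le (w : List (Fin (n - 1))) : len (wordPerm w) ≤ w.length := by
  induction w with
  | nil => simp [wordPerm, len_one]
  | cons i w ih =>
    rw [wordPerm_cons, List.length_cons]
    rcases ascent_or_descent (wordPerm w) i with h | h
    · rw [len_ascent h]; omega
    · have := len_descent h; omega

/-- Without descents the inverse would be increasing, and the only order automorphism of `Fin n` is
the identity. -/
theorem exists_descent {π : Equiv.Perm (Fin n)} (h : π ≠ 1) :
    ∃ i : Fin (n - 1), π⁻¹ (hi i) < π⁻¹ (lo i) := by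
  by_contra! hcon
  apply h
  have hmono : StrictMono ⇑(π⁻¹) := by
    rcases n with _ | n
    · exact fun a => a.elim0
    rw [Fin.strictMono_iff_lt_succ]
    intro i
    exact lt_of_le_of_ne (hcon i) fun h => lo_ne_hi (n := n + 1) i (π⁻¹.injective h)
  have := Subsingleton.elim (hmono.orderIsoOfSurjective _ π⁻¹.surjective) (OrderIso.refl (Fin n))
  rw [← inv_eq_one]
  ext a
  have := congrArg (fun f : Fin n ≃o Fin n => (f a : ℕ)) this
  simpa using this

theorem exists_word_length_eq_len (π : Equiv.Perm (Fin n)) :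
    ∃ w, wordPerm w = π ∧ w.length = len π := by
  induction hN : len π generalizing π with
  | zero =>
    refine ⟨[], ?_, rfl⟩
    by_contra h
    obtain ⟨i, hi⟩ := exists_descent (π := π) fun h' => h (by rw [h']; rfl)
    have := len_descent hi
    omega
  | succ N ih =>
    have h1 : π ≠ 1 := by rintro rfl; rw [len_one] at hN; omega
    obtain ⟨i, hi⟩ := exists_descent h1
    obtain ⟨w, hw, hl⟩ := ih (adjSwap i * π) (by have := len_descent hi; omega)
    exact ⟨i :: w, by rw [wordPerm_cons, hw, adjSwap_mul_adjSwap_mul], by simp [hl]⟩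

theorem wordPerm_minWord (π : Equiv.Perm (Fin n)) : wordPerm (minWord π) = π :=
  Function.argminOn_mem List.length _ (exists_word π)

theorem length_minWord (π : Equiv.Perm (Fin n)) : (minWord π).length = len π := by
  apply le_antisymm
  · obtain ⟨w, hw, hl⟩ := exists_word_length_eq_len π
    rw [← hl]
    exact Function.argminOn_le List.length _ hw
  · have := len_wordPerm_le (minWord π)
    rwa [wordPerm_minWord] at this

/-! ### Matsumoto's theorem for the symmetric group -/

theorem adjSwap_comm {i j : Fin (n - 1)} (hij : (i : ℕ) + 1 < j) :
    adjSwap i * adjSwap j = adjSwap j * adjSwap i := by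
  have : (adjSwap i).Disjoint (adjSwap j) := by
    intro x
    by_cases h : x = lo j ∨ x = hi j
    · left
      apply adjSwap_of_ne <;> rcases h with rfl | rfl <;> simp [lo, hi, Fin.ext_iff] <;> omega
    · right
      push Not at h
      exact adjSwap_of_ne _ h.1 h.2
  exact this.commute

theorem adjSwap_braid {i j : Fin (n - 1)} (hij : (i : ℕ) + 1 = j) :
    adjSwap i * (adjSwap j * adjSwap i) = adjSwap j * (adjSwap i * adjSwap j) := by
  have hj : lo j = hi i := Fin.ext hij.symm
  have h1 : adjSwap i = Equiv.swap (lo i) (hi i) := rfl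
  have h2 : adjSwap j = Equiv.swap (hi i) (hi j) := by rw [← hj]; rfl
  have n1 := lo_ne_hi i
  have n2 : hi i ≠ hi j := by rw [← hj]; exact lo_ne_hi j
  have n3 : lo i ≠ hi j := by simp [lo, hi, Fin.ext_iff]; omega
  rw [← mul_assoc, ← mul_assoc, h1, h2, Equiv.swap_comm (lo i) (hi i),
    Equiv.swap_comm (hi i) (hi j), Equiv.swap_mul_swap_mul_swap n2.symm n3.symm,
    Equiv.swap_comm (hi j) (hi i), Equiv.swap_comm (hi i) (lo i),
    Equiv.swap_mul_swap_mul_swap n1 n3, Equiv.swap_comm]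

/-- A word of minimal length. -/
def Reduced (w : List (Fin (n - 1))) : Prop := w.length = len (wordPerm w)

theorem Reduced.cons_iff {i : Fin (n - 1)} {w : List (Fin (n - 1))} (h : Reduced (i :: w)) :
    Reduced w ∧ (wordPerm (i :: w))⁻¹ (hi i) < (wordPerm (i :: w))⁻¹ (lo i) := by
  have hle := len_wordPerm_le w
  rw [Reduced, wordPerm_cons, List.length_cons] at h
  rw [wordPerm_cons, inv_adjSwap_mul, inv_adjSwap_mul, adjSwap_lo, adjSwap_hi]
  rcases ascent_or_descent (wordPerm w) i with ha | ha
  · have := len_ascent ha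
    exact ⟨by rw [Reduced]; omega, ha⟩
  · have := len_descent ha
    omega

theorem reduced_cons {i : Fin (n - 1)} {w : List (Fin (n - 1))} (h : Reduced w)
    (hd : (adjSwap i * wordPerm w)⁻¹ (hi i) < (adjSwap i * wordPerm w)⁻¹ (lo i)) :
    Reduced (i :: w) := by
  rw [inv_adjSwap_mul, inv_adjSwap_mul, adjSwap_lo, adjSwap_hi] at hd
  rw [Reduced, wordPerm_cons, len_ascent hd, List.length_cons, h]

/-- Reduced words of the same permutation have the same value in every monoid in which the braid
relations hold. -/
theorem Reduced.prod_eq {R : Type*} [Monoid R] (s : Fin (n - 1) → R)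
    (hcomm : ∀ i j : Fin (n - 1), (i : ℕ) + 1 < j → s i * s j = s j * s i)
    (hbraid : ∀ i j : Fin (n - 1), (i : ℕ) + 1 = j → s i * (s j * s i) = s j * (s i * s j)) :
    ∀ (N : ℕ) (u v : List (Fin (n - 1))), u.length = N → Reduced u → Reduced v →
      wordPerm u = wordPerm v → (u.map s).prod = (v.map s).prod := by
  intro N
  induction N using Nat.strong_induction_on with
  | _ N ih =>
  -- Equal first letters cancel; for different ones symmetry allows `i < j`.
  suffices H : ∀ (i j : Fin (n - 1)) (u v : List (Fin (n - 1))), i < j → (i :: u).length = N →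
      Reduced (i :: u) → Reduced (j :: v) → wordPerm (i :: u) = wordPerm (j :: v) →
      ((i :: u).map s).prod = ((j :: v).map s).prod by
    intro u v hN hu hv huv
    have hlen : u.length = v.length := by rw [hu, hv, huv]
    rcases u with _ | ⟨i, u⟩ <;> rcases v with _ | ⟨j, v⟩
    · rfl
    · simp at hlen
    · simp at hlen
    · rcases lt_trichotomy i j with hij | rfl | hij
      · exact H i j u v hij hN hu hv huv
      · rw [wordPerm_cons, wordPerm_cons] at huv
        simp only [List.map_cons, List.prod_cons]
        rw [ih u.length (by simp at hN; omega) u v rfl hu.cons_iff.1 hv.cons_iff.1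
          (mul_left_cancel huv)]
      · exact (H j i v u hij (by rw [← hlen, hN]) hv hu huv.symm).symm
  intro i j u v hij hN hu hv huv
  obtain ⟨hu', hdi⟩ := hu.cons_iff
  obtain ⟨hv', hdj⟩ := hv.cons_iff
  rw [← huv] at hdj
  have hπu : wordPerm u = adjSwap i * wordPerm (i :: u) := by
    rw [wordPerm_cons, adjSwap_mul_adjSwap_mul]
  have hπv : wordPerm v = adjSwap j * wordPerm (i :: u) := by
    rw [huv, wordPerm_cons, adjSwap_mul_adjSwap_mul]
  have hlenv : v.length = u.length := by
    have : (i :: u).length = (j :: v).length := by rw [hu, hv, huv]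
    simpa using this.symm
  have hlenN : u.length < N := by simp at hN; omega
  generalize hπ : wordPerm (i :: u) = π at hdi hdj hπu hπv
  have hred : ∀ ρ : Equiv.Perm (Fin n), ∃ x, wordPerm x = ρ ∧ Reduced x := fun ρ => by
    obtain ⟨x, hx, hl⟩ := exists_word_length_eq_len ρ
    exact ⟨x, hx, by rw [Reduced, hx, hl]⟩
  simp only [List.map_cons, List.prod_cons]
  rcases Nat.lt_or_eq_of_le (Nat.succ_le_of_lt hij) with hfar | hnear
  · have n1 : lo i ≠ lo j := by simp [lo, Fin.ext_iff]; omega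
    have n2 : lo i ≠ hi j := by simp [lo, hi, Fin.ext_iff]; omega
    have n3 : hi i ≠ lo j := by simp [lo, hi, Fin.ext_iff]; omega
    have n4 : hi i ≠ hi j := by simp [hi, Fin.ext_iff]; omega
    -- Since `π` has descents at both `i` and `j`, it has reduced words `i j x` and `j i x`. By
    -- induction `u` agrees with `j x` and `v` with `i x`.
    obtain ⟨x, hx, hxr⟩ := hred (adjSwap j * (adjSwap i * π))
    have hx' : wordPerm x = adjSwap i * (adjSwap j * π) := by
      rw [hx, ← mul_assoc, ← adjSwap_comm hfar, mul_assoc]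
    have r1 : Reduced (j :: x) := reduced_cons hxr (by
      rw [hx, adjSwap_mul_adjSwap_mul, inv_adjSwap_mul, inv_adjSwap_mul,
        adjSwap_of_ne i n1.symm n3.symm, adjSwap_of_ne i n2.symm n4.symm]
      exact hdj)
    have r2 : Reduced (i :: x) := reduced_cons hxr (by
      rw [hx', adjSwap_mul_adjSwap_mul, inv_adjSwap_mul, inv_adjSwap_mul,
        adjSwap_of_ne j n1 n2, adjSwap_of_ne j n3 n4]
      exact hdi)
    rw [ih u.length hlenN u (j :: x) rfl hu' r1 (by
        rw [wordPerm_cons, hx, adjSwap_mul_adjSwap_mul, hπu]),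
      ih v.length (by omega) v (i :: x) rfl hv' r2 (by
        rw [wordPerm_cons, hx', adjSwap_mul_adjSwap_mul, hπv])]
    simp only [List.map_cons, List.prod_cons, ← mul_assoc, hcomm i j hfar]
  · have hnear : (i : ℕ) + 1 = j := hnear
    have hj : lo j = hi i := Fin.ext hnear.symm
    have n2 : lo i ≠ hi j := by simp [lo, hi, Fin.ext_iff]; omega
    have n4 : hi i ≠ hi j := by simp [hi, Fin.ext_iff]; omega
    rw [hj] at hdj
    have si : adjSwap i (hi j) = hi j := adjSwap_of_ne _ n2.symm n4.symm
    have sj : adjSwap j (lo i) = lo i :=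
      adjSwap_of_ne _ (by rw [hj]; exact lo_ne_hi i) n2
    have sj' : adjSwap j (hi i) = hi j := by rw [← hj, adjSwap_lo]
    have sj'' : adjSwap j (hi j) = hi i := by rw [adjSwap_hi, hj]
    -- Two adjacent descents mean that `π` reverses three values, so it has reduced words `i j i x`
    -- and `j i j x`, which the braid relation identifies.
    obtain ⟨x, hx, hxr⟩ := hred (adjSwap i * (adjSwap j * (adjSwap i * π)))
    have hx' : wordPerm x = adjSwap j * (adjSwap i * (adjSwap j * π)) := by
      rw [hx, ← mul_assoc (adjSwap j), ← mul_assoc, adjSwap_braid hnear]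
      simp only [mul_assoc]
    have r1 : Reduced (i :: x) := reduced_cons hxr (by
      rw [hx, adjSwap_mul_adjSwap_mul]
      simp only [inv_adjSwap_mul, sj, sj', si, adjSwap_lo]
      exact hdj)
    have r2 : Reduced (j :: x) := reduced_cons hxr (by
      rw [hx', adjSwap_mul_adjSwap_mul]
      simp only [inv_adjSwap_mul, hj, sj'', si, adjSwap_hi, sj]
      exact hdi)
    have w1 : wordPerm (i :: x) = adjSwap j * (adjSwap i * π) := by
      rw [wordPerm_cons, hx, adjSwap_mul_adjSwap_mul]
    have w2 : wordPerm (j :: x) = adjSwap i * (adjSwap j * π) := by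
      rw [wordPerm_cons, hx', adjSwap_mul_adjSwap_mul]
    have r3 : Reduced (j :: i :: x) := reduced_cons r1 (by
      rw [w1, adjSwap_mul_adjSwap_mul]
      simp only [inv_adjSwap_mul, hj, si, adjSwap_hi]
      exact hdj.trans hdi)
    have r4 : Reduced (i :: j :: x) := reduced_cons r2 (by
      rw [w2, adjSwap_mul_adjSwap_mul]
      simp only [inv_adjSwap_mul, sj', sj]
      exact hdj.trans hdi)
    rw [ih u.length hlenN u (j :: i :: x) rfl hu' r3 (by
        rw [wordPerm_cons, w1, adjSwap_mul_adjSwap_mul, hπu]),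
      ih v.length (by omega) v (i :: j :: x) rfl hv' r4 (by
        rw [wordPerm_cons, w2, adjSwap_mul_adjSwap_mul, hπv])]
    simp only [List.map_cons, List.prod_cons]
    rw [← mul_assoc (s j), ← mul_assoc (s i), ← mul_assoc, ← mul_assoc,
      mul_assoc (s i), hbraid i j hnear]
    simp only [mul_assoc]

/-! ### The Jones–Wenzl idempotent is killed by the generators -/

theorem A_ne_zero : A ≠ 0 := RatFunc.X_ne_zero

/-- Needed to cancel the circle produced when a cup is replaced by a generator. The polynomial `A ^
4 + 1 = -A ^ 2 d` is nonzero since its value at 0 is 1. -/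
theorem d_ne_zero : d ≠ 0 := by
  have hA := A_ne_zero
  intro h
  have h1 : A ^ 4 + 1 = 0 := by
    have : A ^ 4 + 1 = -(A ^ 2 * d) := by
      rw [d]; field_simp; ring
    rw [this, h]; ring
  have h2 : algebraMap (Polynomial ℚ) K (Polynomial.X ^ 4 + 1) = 0 := by
    rw [map_add, map_pow, map_one, RatFunc.algebraMap_X]
    exact h1
  rw [map_eq_zero_iff _ (RatFunc.algebraMap_injective ℚ)] at h2
  have := congrArg (Polynomial.eval 0) h2
  simp at this

/-- Left multiplication. -/
def mulLeft (x : TL n n) : Module.End K (TL n n) := compₗ x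

/-- As a function type `TL n n` carries pointwise multiplication, so ring arguments about stacking
take place in the endomorphism ring, through the faithful left regular representation. -/
theorem mulLeft_comp (x y : TL n n) : mulLeft (comp x y) = mulLeft x * mulLeft y :=
  LinearMap.ext fun z => comp_assoc x y z

theorem mulLeft_injective : Function.Injective (mulLeft : TL n n → _) := fun x y h => by
  have := LinearMap.congr_fun h (wire n n)
  change comp x _ = comp y _ at this
  rwa [comp_wire, comp_wire] at this

theorem mulLeft_crossing (i : Fin (n - 1)) :
    mulLeft (crossing i) = A • 1 + A⁻¹ • mulLeft (e i) := by
  refine LinearMap.ext fun z => ?_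
  have h : compₗ (crossing i) z = A • compₗ (wire n n) z + A⁻¹ • compₗ (e i) z := by
    rw [crossing, map_add, map_smul, map_smul]
    rfl
  exact h.trans (by rw [compₗ_apply, wire_comp]; rfl)

theorem mulLeft_e_mul_self (i : Fin (n - 1)) :
    mulLeft (e i) * mulLeft (e i) = d • mulLeft (e i) := by
  rw [← mulLeft_comp, e_comp_e]
  exact map_smul compₗ d (e i)

theorem smul_one_add_smul_comm {F R : Type*} [Field F] [Ring R] [Algebra F R] (a b : F) {x y : R}
    (h : x * y = y * x) :
    (a • 1 + b • x) * (a • 1 + b • y) = (a • 1 + b • y) * (a • 1 + b • x) := by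
  simp only [add_mul, mul_add, smul_mul_assoc, mul_smul_comm, one_mul, mul_one, h]
  module

/-- The coefficient of `x` is `2a + a⁻¹(-a⁻² - a²) + a⁻³ = a`, so the result is symmetric in `x` and
`y`. This symmetry is the braid relation. -/
theorem braid_expand {F R : Type*} [Field F] [Ring R] [Algebra F R] {a : F} (ha : a ≠ 0) {x y : R}
    (hx : x * x = (-(a⁻¹) ^ 2 - a ^ 2) • x) (hxy : x * (y * x) = x) :
    (a • 1 + a⁻¹ • x) * ((a • 1 + a⁻¹ • y) * (a • 1 + a⁻¹ • x)) =
      a ^ 3 • 1 + a • (x + y) + a⁻¹ • (x * y + y * x) := by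
  simp only [add_mul, mul_add, smul_mul_assoc, mul_smul_comm, one_mul, mul_one, hx, hxy, smul_add,
    smul_smul]
  match_scalars <;> field_simp <;> ring

/-- Removal of a kink: `a + a⁻¹(-a⁻² - a²) = -a⁻³`. -/
theorem mul_smul_one_add_smul {F R : Type*} [Field F] [Ring R] [Algebra F R] {a : F} (ha : a ≠ 0)
    {x : R} (hx : x * x = (-(a⁻¹) ^ 2 - a ^ 2) • x) :
    x * (a • 1 + a⁻¹ • x) = -(a⁻¹) ^ 3 • x := by
  rw [mul_add, mul_smul_comm, mul_smul_comm, mul_one, hx]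
  match_scalars
  field_simp
  ring

theorem crossing_comm {i j : Fin (n - 1)} (hij : (i : ℕ) + 1 < j) :
    mulLeft (crossing i) * mulLeft (crossing j) = mulLeft (crossing j) * mulLeft (crossing i) := by
  rw [mulLeft_crossing, mulLeft_crossing]
  exact smul_one_add_smul_comm _ _ (by rw [← mulLeft_comp, e_comm hij, mulLeft_comp])

theorem crossing_braid {i j : Fin (n - 1)} (hij : (i : ℕ) + 1 = j) :
    mulLeft (crossing i) * (mulLeft (crossing j) * mulLeft (crossing i)) =
      mulLeft (crossing j) * (mulLeft (crossing i) * mulLeft (crossing j)) := by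
  have h2 : mulLeft (e i) * (mulLeft (e j) * mulLeft (e i)) = mulLeft (e i) := by
    rw [← mulLeft_comp, ← mulLeft_comp, e_braid (Or.inl hij)]
  have h3 : mulLeft (e j) * (mulLeft (e i) * mulLeft (e j)) = mulLeft (e j) := by
    rw [← mulLeft_comp, ← mulLeft_comp, e_braid (Or.inr hij)]
  simp only [mulLeft_crossing]
  rw [braid_expand A_ne_zero (mulLeft_e_mul_self i) h2,
    braid_expand A_ne_zero (mulLeft_e_mul_self j) h3,
    add_comm (mulLeft (e i)) (mulLeft (e j)), add_comm (mulLeft (e i) * mulLeft (e j))]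

theorem mulLeft_braidWord (w : List (Fin (n - 1))) :
    mulLeft (braidWord w) = (w.map fun i => mulLeft (crossing i)).prod := by
  induction w with
  | nil => exact LinearMap.ext wire_comp
  | cons i w ih =>
    rw [List.map_cons, List.prod_cons, ← ih, ← mulLeft_comp]
    rfl

theorem braidWord_eq {u v : List (Fin (n - 1))} (hu : Reduced u) (hv : Reduced v)
    (huv : wordPerm u = wordPerm v) : braidWord u = braidWord v := by
  apply mulLeft_injective
  rw [mulLeft_braidWord, mulLeft_braidWord]
  exact Reduced.prod_eq _ (fun i j => crossing_comm) (fun i j => crossing_braid) _ u v rfl hu hv huv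

theorem e_comp_crossing (i : Fin (n - 1)) (x : TL n n) :
    comp (e i) (comp (crossing i) x) = -(A⁻¹) ^ 3 • comp (e i) x := by
  have h : mulLeft (e i) * mulLeft (crossing i) = -(A⁻¹) ^ 3 • mulLeft (e i) := by
    rw [mulLeft_crossing]
    exact mul_smul_one_add_smul A_ne_zero (mulLeft_e_mul_self i)
  exact LinearMap.congr_fun h x

theorem reduced_minWord (π : Equiv.Perm (Fin n)) : Reduced (minWord π) := by
  rw [Reduced, wordPerm_minWord, length_minWord]

/-- The terms of `π` and `s_i π` cancel: the extra crossing costs `-A⁻³` under `e_i`, which the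
extra weight `A³` turns into `-1`. -/
theorem e_comp_jonesWenzl (i : Fin (n - 1)) : comp (e i) (jonesWenzl n) = 0 := by
  rw [jonesWenzl, comp_smul, ← compₗ_apply, map_sum]
  simp only [map_smul, compₗ_apply]
  have key : ∀ π : Equiv.Perm (Fin n), π⁻¹ (lo i) < π⁻¹ (hi i) →
      (A ^ 3) ^ (minWord π).length • comp (e i) (braidWord (minWord π)) +
        (A ^ 3) ^ (minWord (adjSwap i * π)).length •
          comp (e i) (braidWord (minWord (adjSwap i * π))) = 0 := by
    intro π hπ
    have hr : Reduced (i :: minWord π) := reduced_cons (reduced_minWord π) (by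
      rw [wordPerm_minWord, inv_adjSwap_mul, inv_adjSwap_mul, adjSwap_lo, adjSwap_hi]
      exact hπ)
    have h1 : braidWord (minWord (adjSwap i * π)) = comp (crossing i) (braidWord (minWord π)) :=
      braidWord_eq (reduced_minWord _) hr (by
        rw [wordPerm_minWord, wordPerm_cons, wordPerm_minWord])
    have hA := A_ne_zero
    have hc : (A ^ 3) ^ len π + (A ^ 3) ^ (len π + 1) * -(A⁻¹) ^ 3 = 0 := by
      field_simp
      ring
    rw [h1, e_comp_crossing, length_minWord, length_minWord, len_ascent hπ, smul_smul,
      ← add_smul, hc, zero_smul]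
  rw [Finset.sum_involution (fun π _ => adjSwap i * π), smul_zero]
  · intro π _
    rcases ascent_or_descent π i with h | h
    · exact key π h
    · have := key (adjSwap i * π) (by
        rwa [inv_adjSwap_mul, inv_adjSwap_mul, adjSwap_lo, adjSwap_hi])
      rw [adjSwap_mul_adjSwap_mul] at this
      rw [add_comm]
      exact this
  · intro π _ _ h
    have := congrArg (fun ρ => ρ⁻¹ (lo i)) h
    simp only [inv_adjSwap_mul, adjSwap_lo] at this
    exact lo_ne_hi i (π⁻¹.injective this).symm
  · intro π _
    exact Finset.mem_univ _
  · intro π _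
    exact adjSwap_mul_adjSwap_mul i π

/-! ### Orthogonality of the elements `D` -/

theorem exists_adjacent_cup (X : Diagram m n) (h : n < m) :
    ∃ i : Fin (m - 1), X.mate (Sum.inl (lo i)) = Sum.inl (hi i) := by
  -- By pigeonhole not all top points can be joined to the bottom. An innermost arc between top
  -- points then joins neighbours.
  obtain ⟨p, q, hpq, hlt⟩ : ∃ p q : Fin m, X.mate (Sum.inl p) = Sum.inl q ∧ p < q := by
    by_contra! hcon
    have : ∀ p : Fin m, ∃ j : Fin n, X.mate (Sum.inl p) = Sum.inr j := by
      intro p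
      rcases hq : X.mate (Sum.inl p) with q | j
      · have h1 := hcon p q hq
        have h2 := hcon q p (by rw [← hq, X.mate_mate])
        have : q = p := le_antisymm h1 h2
        exact absurd (by rw [hq, this]) (X.mate_ne (Sum.inl p))
      · exact ⟨j, rfl⟩
    choose f hf using this
    have hinj : Function.Injective f := fun p q hpq => by
      have := congrArg X.mate ((hf p).trans ((congrArg Sum.inr hpq).trans (hf q).symm))
      rw [X.mate_mate, X.mate_mate] at this
      exact Sum.inl_injective this
    have := Fintype.card_le_of_injective f hinj
    simp at this
    omega
  induction hg : (q : ℕ) - p using Nat.strong_induction_on generalizing p q with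
  | _ g ih =>
  rw [Fin.lt_def] at hlt
  by_cases h1 : (q : ℕ) = p + 1
  · exact ⟨⟨p, by omega⟩, by rw [show hi _ = q from Fin.ext h1.symm, ← hpq]⟩
  · have hp1 : (p : ℕ) + 1 < m := by omega
    -- The arc at the point just after `p` is trapped under the arc from `p` to `q`, so it is
    -- strictly narrower.
    obtain ⟨r, hr⟩ : ∃ r : Fin m, (r : ℕ) = p + 1 := ⟨⟨p + 1, hp1⟩, rfl⟩
    have hq' : X.mate (Sum.inl q) = Sum.inl p := by rw [← hpq, X.mate_mate]
    have n1 := X.noncrossing (Sum.inl p) (Sum.inl r)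
    have n2 := X.noncrossing (X.mate (Sum.inl r)) (Sum.inl p)
    have hne1 : X.mate (Sum.inl r) ≠ Sum.inl p := fun h => by
      have := congrArg X.mate h
      rw [X.mate_mate, hpq] at this
      simp [Fin.ext_iff] at this
      omega
    have hne3 : X.mate (Sum.inl r) ≠ Sum.inl q := fun h => by
      rw [← hpq] at h
      have := congrArg X.mate h
      rw [X.mate_mate, X.mate_mate] at this
      simp [Fin.ext_iff] at this
      omega
    have hne2 := X.mate_ne (Sum.inl r)
    rw [X.mate_mate] at n2
    rw [hpq] at n1 n2
    rcases hs : X.mate (Sum.inl r) with s | s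
    · rw [hs] at n1 n2 hne1 hne2 hne3
      simp only [pos, ne_eq, Sum.inl.injEq, Fin.ext_iff] at n1 n2 hne1 hne2 hne3
      exact ih (s - r) (by omega) r s hs (by rw [Fin.lt_def]; omega) rfl
    · rw [hs] at n1
      have := s.isLt
      simp only [pos] at n1
      omega

theorem reflect_e (i : Fin (n - 1)) : reflect (e i) = e i := by
  rw [e_eq, reflect_single]
  congr 1
  ext1
  funext p
  rcases p with p | p <;> simp only [Diagram.reflect, Diagram.e, Sum.swap_inl, Sum.swap_inr,
    Sum.elim_inl, Sum.elim_inr] <;> split_ifs <;> rfl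

/-- There is no nonzero morphism between different Jones–Wenzl idempotents. -/
theorem jonesWenzl_comp_jonesWenzl (h : m ≠ n) (y : TL m n) :
    comp (reflect (jonesWenzl m)) (comp y (jonesWenzl n)) = 0 := by
  refine LinearMap.congr_fun (f := compₗ (reflect (jonesWenzl m)) ∘ₗ compₗ.flip (jonesWenzl n))
    (g := 0) (ext_single fun X => ?_) y
  change comp (reflect (jonesWenzl m)) (comp (single X) (jonesWenzl n)) = 0
  rcases lt_or_gt_of_ne h with hlt | hlt
  · obtain ⟨i, hi⟩ := exists_adjacent_cup X.reflect hlt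
    have h1 := congrArg reflect (e_comp_single hi)
    rw [reflect_comp, reflect_smul, reflect_single, reflect_reflect, reflect_e] at h1
    -- `d X = X e_i`, because `X` has an arc joining two neighbouring bottom points; then `e_i`
    -- meets `f_n`.
    have : d • comp (single X) (jonesWenzl n) = 0 := by
      rw [← smul_comp, ← h1, comp_assoc, e_comp_jonesWenzl, comp_zero]
    rw [(smul_eq_zero.1 this).resolve_left d_ne_zero, comp_zero]
  · obtain ⟨i, hi⟩ := exists_adjacent_cup X hlt
    have h4 : comp (reflect (jonesWenzl m)) (e i) = 0 := by
      rw [← reflect_e, ← reflect_comp, e_comp_jonesWenzl, reflect_zero]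
    have : d • comp (reflect (jonesWenzl m)) (single X) = 0 := by
      rw [← comp_smul, ← e_comp_single hi, ← comp_assoc, h4, zero_comp]
    rw [← comp_assoc, (smul_eq_zero.1 this).resolve_left d_ne_zero, zero_comp]

/-- Half trees with different labels are orthogonal. -/
theorem halfTree_orthogonal (s t : ℕ → ℕ) (h1 : s 1 = t 1) (k c c' : ℕ) (hk : 1 ≤ k)
    (hc : s k = c) (hc' : t k = c') (hne : ∃ i, 1 ≤ i ∧ i ≤ k ∧ s i ≠ t i) :
    comp (reflect (halfTree s k c)) (halfTree t k c') = 0 := by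
  induction k, hk using Nat.le_induction generalizing c c' with
  | base =>
    obtain ⟨i, hi, hi', h⟩ := hne
    obtain rfl : i = 1 := le_antisymm hi' hi
    exact absurd h1 h
  | succ k hk ih =>
    obtain ⟨k, rfl⟩ := Nat.exists_eq_add_of_le' hk
    simp only [halfTree, triplePoint]
    by_cases hcc : c = c'
    · have hinner := ih _ _ rfl rfl (by
        obtain ⟨i, hi, hi', h⟩ := hne
        refine ⟨i, hi, ?_, h⟩
        rcases Nat.lt_or_eq_of_le hi' with h2 | rfl
        · omega
        · exact absurd (by rw [hc, hc', hcc]) h)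
      rw [reflect_comp, reflect_addLeft, comp_assoc,
        ← comp_assoc (addLeft (reflect (halfTree s (k + 1) (s (k + 1))))), ← addLeft_comp, hinner,
        addLeft_zero, zero_comp, comp_zero]
    · simp only [reflect_comp, comp_assoc]
      -- Regroup so that everything between the two outermost idempotents becomes a single morphism.
      simp only [← comp_assoc _ _ (jonesWenzl c')]
      rw [comp_assoc _ _ (jonesWenzl c')]
      exact jonesWenzl_comp_jonesWenzl hcc _

theorem reflect_reflect_apply (x : TL m n) : reflect (reflect x) = x :=
  funext fun D => congrArg x (reflect_reflect D)

theorem form_D_eq_zero {n : ℕ} (hn : 1 ≤ n) {a b : ℕ → ℕ} (ha : Admissible n a)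
    (hb : Admissible n b) (hab : ∃ i, 1 ≤ i ∧ i ≤ 2 * n - 1 ∧ a i ≠ b i) :
    form (D n a) (D n b) = 0 := by
  rw [form_eq_form_comp_reflect, D, D, reflect_comp, reflect_reflect_apply, comp_assoc]
  obtain ⟨i, hi, hi', h⟩ := hab
  have hr : 2 * n - n = n := by omega
  rcases le_or_gt i n with hin | hin
  -- Rotating the product cyclically puts the reflected upper half of `D n b` directly above the
  -- upper half of `D n a`.
  · rw [form_comp_comm, comp_assoc, comp_assoc,
      halfTree_orthogonal b a (hb.first.trans ha.first.symm) n _ _ hn rfl rfl ⟨i, hi, hin, h.symm⟩,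
      comp_zero, comp_zero, form_zero]
  -- The lower halves are already adjacent. They are read from the bottom, so index `i` becomes `2 *
  -- n - i`, and the common index `n` is fixed.
  · rw [← comp_assoc (reflect _),
      halfTree_orthogonal (fun i => a (2 * n - i)) (fun i => b (2 * n - i))
        (ha.last.trans hb.last.symm) n _ _ hn (by rw [hr]) (by rw [hr])
        ⟨2 * n - i, by omega, by omega, by rwa [show 2 * n - (2 * n - i) = i by omega]⟩,
      zero_comp, comp_zero, form_zero]

end TemperleyLieb

end

theorem mainTheorem2 (n : ℕ) (hn : 1 ≤ n) (a b : ℕ → ℕ)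
    (ha : TemperleyLieb.Admissible n a) (hb : TemperleyLieb.Admissible n b)
    (hab : ∃ i, 1 ≤ i ∧ i ≤ 2 * n - 1 ∧ a i ≠ b i) :
    TemperleyLieb.form (TemperleyLieb.D n a) (TemperleyLieb.D n b) = 0 :=
  TemperleyLieb.form_D_eq_zero hn ha hb hab
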